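/- Let $X$ be a smooth complex projective variety, let $G$ be a complex reductive (linear) algebraic group, let $D(G)\subset G$ be its derived subgroup (the smallest closed subgroup containing all commutators), and let $\operatorname{rad}\colon G\to R=G/D(G)$ be the quotient homomorphism. A \emph{principal Higgs $G$-bundle} on $X$ is a pair $\mathfrak E=(E,\phi)$ consisting of a principal $G$-bundle $E\to X$ and a global section $\phi$ of $\operatorname{Ad}(E)\otimes\Omega^1_X$ such that $[\phi,\phi]=0$ in $\operatorname{Ad}(E)\otimes\Omega^2_X$; it is \emph{trivial} if the principal bundle $E$ is trivial and $\phi=0$. The \emph{radical} $R(\mathfrak E)$ of $\mathfrak E$ is the principal Higgs $R$-bundle $\mathfrak E\times_{\operatorname{rad}}R\simeq \mathfrak E/D(G)$ obtained from $\mathfrak E$ by extending the structure group along $\operatorname{rad}$, equipped with the Higgs field induced by $\phi$. For a closed subgroup $K\subset G$, a \emph{Higgs reduction} of $\mathfrak E$ to $K$ is a reduction of the structure group of $E$ to $K$, i.e. a principal $K$-bundle $F\to X$ with an injective $K$-equivariant morphism $F\to E$ over $X$, such that $\phi$ lies in the kernel of the projection $\operatorname{Ad}(E)\otimes\Omega^1_X\to(\operatorname{Ad}(E)/\operatorname{Ad}(F))\otimes\Omega^1_X$.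 Let $\mathfrak E=(E,\phi)$ be a principal Higgs $G$-bundle on $X$. Then $R(\mathfrak E)$ is trivial as a principal Higgs $R$-bundle if and only if $\mathfrak E$ admits a Higgs reduction of its structure group to the derived subgroup $D(G)$. -/

import Mathlib

open CategoryTheory AlgebraicGeometry MonoidalCategory CartesianMonoidalCategory
open scoped TensorProduct MonObj WithConv commutatorElement

noncomputable section

namespace PrincipalHiggs

/-! ## Complex schemes and smooth projective varieties -/

/-- The category of complex schemes. -/
abbrev CSch := Over (Spec (.of ℂ))

/-- The ring of regular functions on the open subset `U` of the complex scheme `Y`. -/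
def Fn (Y : CSch) (U : Y.left.Opens) : Type := Γ(Y.left, U)

instance (Y : CSch) (U : Y.left.Opens) : CommRing (Fn Y U) :=
  inferInstanceAs (CommRing Γ(Y.left, U))

/-- The complex numbers as constant functions, via the structure morphism `Y ⟶ Spec ℂ`. -/
instance (Y : CSch) (U : Y.left.Opens) : Algebra ℂ (Fn Y U) :=
  ((Scheme.ΓSpecIso (.of ℂ)).inv ≫ Y.hom.appLE ⊤ U le_top).hom.toAlgebra

/-- Pullback of regular functions along a morphism `f : Y ⟶ Z` of complex schemes, from `V ⊆ Z`
to an open `U ⊆ Y` that is mapped into `V`. -/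
def pullFn {Y Z : CSch} (f : Y ⟶ Z) (V : Z.left.Opens) (U : Y.left.Opens)
    (h : U ≤ f.left ⁻¹ᵁ V) : Fn Z V →ₐ[ℂ] Fn Y U where
  __ := (f.left.appLE V U h).hom
  commutes' c := by
    have key : ∀ (k : Y.left ⟶ Spec (.of ℂ)), k = Y.hom →
        ∀ e, k.appLE ⊤ U e = Y.hom.appLE ⊤ U (by exact le_top) := by
      rintro _ rfl _; rfl
    have e : Z.hom.appLE ⊤ V (by exact le_top) ≫ f.left.appLE V U h =
        Y.hom.appLE ⊤ U (by exact le_top) :=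
      (Scheme.Hom.appLE_comp_appLE _ _ _ _ _ _ _).trans (key _ (Over.w f) _)
    exact congrArg (fun k => ((Scheme.ΓSpecIso (.of ℂ)).inv ≫ k).hom c) e

lemma pullFn_pullFn {Y Z W : CSch} (f : Y ⟶ Z) (g : Z ⟶ W) (T : W.left.Opens) (V : Z.left.Opens)
    (U : Y.left.Opens) (h : V ≤ g.left ⁻¹ᵁ T) (h' : U ≤ f.left ⁻¹ᵁ V)
    (k : U ≤ (f ≫ g).left ⁻¹ᵁ T) (x : Fn W T) :
    pullFn f V U h' (pullFn g T V h x) = pullFn (f ≫ g) T U k x := by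
  change (g.left.appLE T V h ≫ f.left.appLE V U h').hom x = ((f ≫ g).left.appLE T U k).hom x
  rw [Scheme.Hom.appLE_comp_appLE]
  rfl

lemma pullFn_congr {Y Z : CSch} {f f' : Y ⟶ Z} (e : f = f') (V : Z.left.Opens)
    (U : Y.left.Opens) (h : U ≤ f.left ⁻¹ᵁ V) (h' : U ≤ f'.left ⁻¹ᵁ V) (x : Fn Z V) :
    pullFn f V U h x = pullFn f' V U h' x := by
  subst e; rfl

attribute [local instance] MvPolynomial.gradedAlgebra in
/-- Complex projective space of dimension `n`, as a complex scheme. -/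
def projSpace (n : ℕ) : CSch :=
  Over.mk (Proj.toSpecZero (MvPolynomial.homogeneousSubmodule (Fin (n + 1)) ℂ) ≫
    Spec.map (CommRingCat.ofHom
      (algebraMap ℂ (MvPolynomial.homogeneousSubmodule (Fin (n + 1)) ℂ 0))))

/-- Smooth complex projective varieties: integral smooth complex schemes that admit a closed
embedding into a projective space. -/
structure IsSmoothProjectiveVariety (X : CSch) : Prop where
  isIntegral : IsIntegral X.left
  smooth : Smooth X.hom
  projective : ∃ (n : ℕ) (j : X ⟶ projSpace n), IsClosedImmersion j.left

/-! ## Complex affine algebraic groups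

A (linear) complex algebraic group `G` is given by its coordinate ring `H = ℂ[G]`, a commutative
Hopf algebra that is finitely generated as an algebra; `G = Spec H`. Closed subgroups of `G`
correspond to Hopf ideals `I` of `H`, the coordinate ring of the subgroup being `H ⧸ I`. -/

section Groups

variable (H : Type) [CommRing H] [HopfAlgebra ℂ H]

/-- The group scheme `Spec H` of the commutative Hopf algebra `H`; its group structure is provided
by Mathlib. -/
abbrev grp : CSch := (Spec (.of H)).asOver (Spec (.of ℂ))

/-- The universal commutator `(x, y) ↦ x y x⁻¹ y⁻¹`, on coordinate rings. -/
def commutatorHom : H →ₐ[ℂ] H ⊗[ℂ] H :=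
  (⁅WithConv.toConv (Algebra.TensorProduct.includeLeft : H →ₐ[ℂ] H ⊗[ℂ] H),
    WithConv.toConv (Algebra.TensorProduct.includeRight : H →ₐ[ℂ] H ⊗[ℂ] H)⁆).ofConv

/-- The ideal of the derived subgroup `D(G)`, i.e. of the smallest closed subgroup of `G` that
contains all commutators: the sum of all Hopf ideals contained in the kernel of the commutator
homomorphism. -/
def derivedIdeal : Ideal H :=
  sSup {J : Ideal H | J.IsHopfIdeal ℂ ∧ J ≤ RingHom.ker (commutatorHom H)}

instance : (derivedIdeal H).IsHopfIdeal ℂ := by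
  have key : ∀ K : Ideal H, (∀ J : Ideal H, J.IsHopfIdeal ℂ → J ≤ derivedIdeal H → J ≤ K) →
      derivedIdeal H ≤ K := fun K hK =>
    sSup_le fun J hJ => hK J hJ.1 (le_sSup hJ)
  have h1 : derivedIdeal H ≤ RingHom.ker (Bialgebra.counitAlgHom ℂ H) :=
    key _ fun J hJ _ x hx => hJ.counit_eq_zero hx
  have h2 : derivedIdeal H ≤ RingHom.ker
      ((Algebra.TensorProduct.map (Ideal.Quotient.mkₐ ℂ (derivedIdeal H))
        (Ideal.Quotient.mkₐ ℂ (derivedIdeal H))).comp (Bialgebra.comulAlgHom ℂ H)) := by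
    refine key _ fun J hJ hle x hx => ?_
    have hx0 : Algebra.TensorProduct.map (Ideal.Quotient.mkₐ ℂ J) (Ideal.Quotient.mkₐ ℂ J)
        (Coalgebra.comul (R := ℂ) x) = 0 := hJ.map_mkQ_comul_eq_zero hx
    have hf : (Ideal.Quotient.factorₐ ℂ hle).comp (Ideal.Quotient.mkₐ ℂ J) =
        Ideal.Quotient.mkₐ ℂ (derivedIdeal H) := rfl
    rw [RingHom.mem_ker, ← hf, Algebra.TensorProduct.map_comp]
    simp [hx0]
  have h3 : derivedIdeal H ≤
      (derivedIdeal H).comap (HopfAlgebra.antipodeAlgHom ℂ H) :=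
    key _ fun J hJ hle x hx => hle (hJ.antipode_mem hx)
  exact
    { counit_eq_zero := fun x hx => h1 hx
      map_mkQ_comul_eq_zero := fun x hx => h2 hx
      antipode_mem := fun x hx => h3 hx }

/-- The coordinate ring of the derived subgroup `D(G)`. -/
abbrev Derived : Type := H ⧸ derivedIdeal H

/-- The inclusion `D(G) → G`, on coordinate rings. -/
abbrev derivedIncl : H →ₐc[ℂ] Derived H := Bialgebra.Quotient.mkBialgHom (derivedIdeal H)

/-- The algebraic group with coordinate ring `K` is unipotent: every nonzero finite dimensional
representation (that is, comodule `ρ : V → V ⊗ K`) has a nonzero fixed vector. -/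
def IsUnipotent (K : Type) [CommRing K] [HopfAlgebra ℂ K] : Prop :=
  ∀ (V : Type) [AddCommGroup V] [Module ℂ V] [FiniteDimensional ℂ V] [Nontrivial V]
    (ρ : V →ₗ[ℂ] V ⊗[ℂ] K),
    (TensorProduct.assoc ℂ V K K).toLinearMap ∘ₗ ρ.rTensor K ∘ₗ ρ =
      Coalgebra.comul.lTensor V ∘ₗ ρ →
    (TensorProduct.rid ℂ V).toLinearMap ∘ₗ Coalgebra.counit.lTensor V ∘ₗ ρ = LinearMap.id →
    ∃ v : V, v ≠ 0 ∧ ρ v = v ⊗ₜ 1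

/-- The closed subgroup `N = Spec (H ⧸ J)` of `G` is normal: `(g, n) ↦ g n g⁻¹` maps `G × N`
into `N`. -/
def IsNormalIdeal (J : Ideal H) [J.IsHopfIdeal ℂ] : Prop :=
  J ≤ RingHom.ker
    (WithConv.toConv (Algebra.TensorProduct.includeLeft : H →ₐ[ℂ] H ⊗[ℂ] (H ⧸ J)) *
      WithConv.toConv ((Algebra.TensorProduct.includeRight : H ⧸ J →ₐ[ℂ] H ⊗[ℂ] (H ⧸ J)).comp
        (Ideal.Quotient.mkₐ ℂ J)) *
      (WithConv.toConv (Algebra.TensorProduct.includeLeft : H →ₐ[ℂ] H ⊗[ℂ] (H ⧸ J)))⁻¹).ofConv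

/-- A complex affine algebraic group is reductive if its unipotent radical is trivial, i.e. if its
only connected normal unipotent closed subgroup is the trivial group (whose ideal is the kernel of
the counit). -/
def IsReductive : Prop :=
  ∀ (J : Ideal H) [J.IsHopfIdeal ℂ], IsNormalIdeal H J → ConnectedSpace (PrimeSpectrum (H ⧸ J)) →
    IsUnipotent (H ⧸ J) → J = RingHom.ker (Bialgebra.counitAlgHom ℂ H)

variable {H}

/-- A homomorphism of algebraic groups `G → G'`, given on coordinate rings by `l : ℂ[G'] → ℂ[G]`,
as a morphism of complex schemes. -/
def grpHom {H' : Type} [CommRing H'] [HopfAlgebra ℂ H'] (l : H' →ₐc[ℂ] H) : grp H ⟶ grp H' :=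
  (Spec.map (CommRingCat.ofHom (l : H' →ₐ[ℂ] H).toRingHom)).asOver (Spec (.of ℂ))

/-- The homomorphism of algebraic groups `G → R`, given on coordinate rings by
`l : ℂ[R] → ℂ[G]`, is the quotient of `G` by the closed subgroup with ideal `I`: it is faithfully
flat, and its scheme-theoretic kernel is that subgroup. -/
structure IsQuotientHom {R : Type} [CommRing R] [HopfAlgebra ℂ R] (l : R →ₐc[ℂ] H)
    (I : Ideal H) : Prop where
  faithfullyFlat : (l : R →ₐ[ℂ] H).toRingHom.FaithfullyFlat
  kernel : (RingHom.ker (Bialgebra.counitAlgHom ℂ R)).map (l : R →ₐ[ℂ] H) = I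

end Groups

/-! ## Lie algebra valued functions -/

section LieValued

variable (H : Type) [CommRing H] [HopfAlgebra ℂ H]
variable (A B C : Type) [CommRing A] [Algebra ℂ A] [CommRing B] [Algebra ℂ B] [Algebra A B]
  [IsScalarTower ℂ A B] [CommRing C] [Algebra ℂ C] [Algebra A C] [IsScalarTower ℂ A C]

/-- Functions on `Spec B` with values in the Lie algebra `𝔤` of `G = Spec H`, that is,
derivations `H → B` at the unit element of `G`. -/
def lieValued : Submodule B (H →ₗ[ℂ] B) where
  carrier := {D | ∀ x y : H, D (x * y) =
    (Coalgebra.counit x : ℂ) • D y + (Coalgebra.counit y : ℂ) • D x}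
  add_mem' {D D'} hD hD' x y := by
    simp only [LinearMap.add_apply, hD x y, hD' x y, smul_add]; abel
  zero_mem' x y := by simp
  smul_mem' b D hD x y := by
    simp only [LinearMap.smul_apply, hD x y, smul_add, smul_comm b]

variable {H A B C}

/-- For a `C`-valued point `g` of `G` and a `𝔤`-valued function `ξ` on `Spec C`, the function
`Ad(g⁻¹) ξ = g⁻¹ ξ g`; the products are convolution products, and `g⁻¹` is `g` composed with the
antipode. -/
def adInv (g : H →ₐ[ℂ] C) (ξ : H →ₗ[ℂ] C) : H →ₗ[ℂ] C :=
  (WithConv.toConv (g.toLinearMap ∘ₗ HopfAlgebra.antipode ℂ) * WithConv.toConv ξ *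
    WithConv.toConv g.toLinearMap).ofConv

/-- The `𝔤`-valued functions `ξ` on `Spec B` with `ξ(a(z)) = Ad(g(z)⁻¹) ξ(p(z))` for all points
`z` of `Spec C`, where `p, a : Spec C → Spec B` and `g : Spec C → G` are given. -/
def equivariant (p a : B →ₐ[A] C) (g : H →ₐ[ℂ] C) : Submodule A (H →ₗ[ℂ] B) where
  carrier := {ξ | ξ ∈ lieValued H B ∧
    (a.restrictScalars ℂ).toLinearMap ∘ₗ ξ = adInv g ((p.restrictScalars ℂ).toLinearMap ∘ₗ ξ)}
  add_mem' {ξ ξ'} hξ hη := by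
    refine ⟨add_mem hξ.1 hη.1, ?_⟩
    rw [LinearMap.comp_add, LinearMap.comp_add, hξ.2, hη.2]
    simp [adInv, mul_add, add_mul]
  zero_mem' := by
    refine ⟨zero_mem _, ?_⟩
    simp [adInv]
  smul_mem' c ξ hξ := by
    have h : ∀ f : B →ₐ[A] C, (f.restrictScalars ℂ).toLinearMap ∘ₗ (c • ξ) =
        c • ((f.restrictScalars ℂ).toLinearMap ∘ₗ ξ) := by
      intro f; ext x; simp
    refine ⟨fun x y => ?_, ?_⟩
    · simp only [LinearMap.smul_apply, hξ.1 x y, smul_add, smul_comm c]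
    · rw [h, h, hξ.2]
      simp [adInv]

/-- The bracket `[ξ, ξ']` of two Lie algebra valued functions, the commutator for the convolution
product. -/
def lieBracket (ξ ξ' : H →ₗ[ℂ] B) : H →ₗ[ℂ] B :=
  (WithConv.toConv ξ * WithConv.toConv ξ' - WithConv.toConv ξ' * WithConv.toConv ξ).ofConv

lemma lieBracket_mem {ξ ξ' : H →ₗ[ℂ] B} (hξ : ξ ∈ lieValued H B) (hξ' : ξ' ∈ lieValued H B) :
    lieBracket ξ ξ' ∈ lieValued H B := by
  have conv : ∀ (D D' : H →ₗ[ℂ] B), D ∈ lieValued H B → D' ∈ lieValued H B → ∀ x y : H,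
      (WithConv.toConv D * WithConv.toConv D') (x * y) =
        (Coalgebra.counit x : ℂ) • (WithConv.toConv D * WithConv.toConv D') y +
        (Coalgebra.counit y : ℂ) • (WithConv.toConv D * WithConv.toConv D') x +
        (D x * D' y + D y * D' x) := by
    intro D D' hD hD' x y
    let r := Coalgebra.Repr.arbitrary ℂ x
    let s := Coalgebra.Repr.arbitrary ℂ y
    have hr : ∑ i ∈ r.index, (Coalgebra.counit (r.left i) : ℂ) • r.right i = x :=
      Coalgebra.sum_counit_smul r
    have hs : ∑ j ∈ s.index, (Coalgebra.counit (s.left j) : ℂ) • s.right j = y :=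
      Coalgebra.sum_counit_smul s
    have hr' : ∑ i ∈ r.index, (Coalgebra.counit (r.right i) : ℂ) • r.left i = x := by
      have h := congrArg (TensorProduct.rid ℂ H) (Coalgebra.sum_tmul_counit_eq r)
      simpa only [map_sum, TensorProduct.rid_tmul, one_smul] using h
    have hs' : ∑ j ∈ s.index, (Coalgebra.counit (s.right j) : ℂ) • s.left j = y := by
      have h := congrArg (TensorProduct.rid ℂ H) (Coalgebra.sum_tmul_counit_eq s)
      simpa only [map_sum, TensorProduct.rid_tmul, one_smul] using h
    have hxy : (WithConv.toConv D * WithConv.toConv D') (x * y) =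
        ∑ i ∈ r.index, ∑ j ∈ s.index,
          D (r.left i * s.left j) * D' (r.right i * s.right j) := by
      rw [LinearMap.convMul_apply, Bialgebra.comul_mul, ← r.eq, ← s.eq, Finset.sum_mul_sum]
      simp
    have hx : (WithConv.toConv D * WithConv.toConv D') x =
        ∑ i ∈ r.index, D (r.left i) * D' (r.right i) := r.convMul_apply _ _
    have hy : (WithConv.toConv D * WithConv.toConv D') y =
        ∑ j ∈ s.index, D (s.left j) * D' (s.right j) := s.convMul_apply _ _
    have ex : (Coalgebra.counit x : ℂ) =
        ∑ i ∈ r.index, Coalgebra.counit (r.left i) * Coalgebra.counit (r.right i) := by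
      conv_lhs => rw [← hr]
      simp
    have ey : (Coalgebra.counit y : ℂ) =
        ∑ j ∈ s.index, Coalgebra.counit (s.left j) * Coalgebra.counit (s.right j) := by
      conv_lhs => rw [← hs]
      simp
    have dx : D x = ∑ i ∈ r.index, (Coalgebra.counit (r.right i) : ℂ) • D (r.left i) := by
      conv_lhs => rw [← hr']
      simp
    have dy : D y = ∑ j ∈ s.index, (Coalgebra.counit (s.right j) : ℂ) • D (s.left j) := by
      conv_lhs => rw [← hs']
      simp
    have dx' : D' x = ∑ i ∈ r.index, (Coalgebra.counit (r.left i) : ℂ) • D' (r.right i) := by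
      conv_lhs => rw [← hr]
      simp
    have dy' : D' y = ∑ j ∈ s.index, (Coalgebra.counit (s.left j) : ℂ) • D' (s.right j) := by
      conv_lhs => rw [← hs]
      simp
    rw [hxy, hx, hy, ex, ey, dx, dy, dx', dy', Finset.sum_smul_sum, Finset.sum_smul_sum,
      Finset.sum_mul_sum, Finset.sum_mul_sum,
      Finset.sum_comm (s := s.index) (t := r.index), Finset.sum_comm (s := s.index) (t := r.index),
      ← Finset.sum_add_distrib, ← Finset.sum_add_distrib, ← Finset.sum_add_distrib]
    refine Finset.sum_congr rfl fun i _ => ?_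
    rw [← Finset.sum_add_distrib, ← Finset.sum_add_distrib, ← Finset.sum_add_distrib]
    refine Finset.sum_congr rfl fun j _ => ?_
    rw [hD, hD']
    simp only [Algebra.smul_def, map_mul]
    ring
  intro x y
  change (WithConv.toConv ξ * WithConv.toConv ξ') (x * y) -
    (WithConv.toConv ξ' * WithConv.toConv ξ) (x * y) =
    (Coalgebra.counit x : ℂ) • ((WithConv.toConv ξ * WithConv.toConv ξ') y -
      (WithConv.toConv ξ' * WithConv.toConv ξ) y) +
    (Coalgebra.counit y : ℂ) • ((WithConv.toConv ξ * WithConv.toConv ξ') x -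
      (WithConv.toConv ξ' * WithConv.toConv ξ) x)
  rw [conv _ _ hξ hξ', conv _ _ hξ' hξ, smul_sub, smul_sub]
  ring

lemma adInv_mul (g : H →ₐ[ℂ] C) (ξ ξ' : H →ₗ[ℂ] C) :
    WithConv.toConv (adInv g ξ) * WithConv.toConv (adInv g ξ') =
      WithConv.toConv (adInv g (WithConv.toConv ξ * WithConv.toConv ξ').ofConv) := by
  have h : WithConv.toConv g.toLinearMap *
      WithConv.toConv (g.toLinearMap ∘ₗ HopfAlgebra.antipode ℂ) = 1 := by
    have h1 := LinearMap.algHom_comp_convMul_distrib g (WithConv.toConv LinearMap.id)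
      (WithConv.toConv (HopfAlgebra.antipode ℂ (A := H)))
    rw [LinearMap.id_mul_antipode] at h1
    refine Eq.trans (congrArg WithConv.toConv h1).symm ?_
    ext x
    simp
  simp only [adInv, WithConv.toConv_ofConv]
  simp only [mul_assoc]
  rw [← mul_assoc (WithConv.toConv g.toLinearMap), h, one_mul]

lemma lieBracket_equivariant {p a : B →ₐ[A] C} {g : H →ₐ[ℂ] C} {ξ ξ' : H →ₗ[ℂ] B}
    (hξ : ξ ∈ equivariant p a g) (hξ' : ξ' ∈ equivariant p a g) :
    lieBracket ξ ξ' ∈ equivariant p a g := by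
  refine ⟨lieBracket_mem hξ.1 hξ'.1, ?_⟩
  have hcomp : ∀ f : B →ₐ[ℂ] C, f.toLinearMap ∘ₗ lieBracket ξ ξ' =
      lieBracket (f.toLinearMap ∘ₗ ξ) (f.toLinearMap ∘ₗ ξ') := by
    intro f
    have h1 := LinearMap.algHom_comp_convMul_distrib f (WithConv.toConv ξ) (WithConv.toConv ξ')
    have h2 := LinearMap.algHom_comp_convMul_distrib f (WithConv.toConv ξ') (WithConv.toConv ξ)
    simp only [lieBracket, WithConv.ofConv_sub, LinearMap.comp_sub, h1, h2]
  rw [hcomp, hcomp, hξ.2, hξ'.2]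
  simp only [lieBracket, adInv_mul]
  simp [adInv, mul_sub, sub_mul]

/-- The bracket of equivariant Lie algebra valued functions, as a bilinear map. -/
def bracket (p a : B →ₐ[A] C) (g : H →ₐ[ℂ] C) :
    equivariant p a g →ₗ[A] equivariant p a g →ₗ[A] equivariant p a g :=
  LinearMap.mk₂ A (fun ξ ξ' => ⟨lieBracket ξ.1 ξ'.1, lieBracket_equivariant ξ.2 ξ'.2⟩)
    (fun _ _ _ => Subtype.ext (by simp [lieBracket, add_mul, mul_add]; abel))
    (fun _ _ _ => Subtype.ext (by simp [lieBracket, smul_sub]))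
    (fun _ _ _ => Subtype.ext (by simp [lieBracket, add_mul, mul_add]; abel))
    (fun _ _ _ => Subtype.ext (by simp [lieBracket, smul_sub]))

variable (A) in
/-- The exterior product of Kähler differentials `Ω¹ × Ω¹ → Ω² = ⋀² Ω¹`. -/
def wedge : Ω[A⁄ℂ] →ₗ[A] Ω[A⁄ℂ] →ₗ[A] ⋀[A]^2 Ω[A⁄ℂ] :=
  have e0 : ∀ x y z : Ω[A⁄ℂ], Function.update ![x, y] 0 z = ![z, y] := fun x y z => by
    ext i; fin_cases i <;> rfl
  have e1 : ∀ x y z : Ω[A⁄ℂ], Function.update ![x, y] 1 z = ![x, z] := fun x y z => by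
    ext i; fin_cases i <;> rfl
  LinearMap.mk₂ A (fun x y => exteriorPower.ιMulti A 2 ![x, y])
    (fun x x' y => by
      have h := (exteriorPower.ιMulti A 2 (M := Ω[A⁄ℂ])).map_update_add ![x, y] 0 x x'
      rwa [e0, e0, e0] at h)
    (fun c x y => by
      have h := (exteriorPower.ιMulti A 2 (M := Ω[A⁄ℂ])).map_update_smul ![x, y] 0 c x
      rwa [e0, e0] at h)
    (fun x y y' => by
      have h := (exteriorPower.ιMulti A 2 (M := Ω[A⁄ℂ])).map_update_add ![x, y] 1 y y'
      rwa [e1, e1, e1] at h)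
    (fun c x y => by
      have h := (exteriorPower.ιMulti A 2 (M := Ω[A⁄ℂ])).map_update_smul ![x, y] 1 c y
      rwa [e1, e1] at h)

/-- Composition with algebra homomorphisms that are compatible with `p`, `a` and `g` preserves
equivariance. -/
lemma equivariant_comp {A' B' C' : Type} [CommRing A'] [CommRing B']
    [Algebra ℂ B'] [Algebra A' B'] [CommRing C'] [Algebra ℂ C'] [Algebra A' C'] [Algebra ℂ A']
    [IsScalarTower ℂ A' B'] [IsScalarTower ℂ A' C']
    {p a : B →ₐ[A] C} {g : H →ₐ[ℂ] C} {p' a' : B' →ₐ[A'] C'} {g' : H →ₐ[ℂ] C'}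
    (rB : B →ₐ[ℂ] B') (rC : C →ₐ[ℂ] C') (hp : ∀ b, p' (rB b) = rC (p b))
    (ha : ∀ b, a' (rB b) = rC (a b)) (hg : ∀ x, g' x = rC (g x))
    {ξ : H →ₗ[ℂ] B} (hξ : ξ ∈ equivariant p a g) :
    rB.toLinearMap ∘ₗ ξ ∈ equivariant p' a' g' := by
  refine ⟨fun x y => ?_, ?_⟩
  · simp [hξ.1 x y]
  · have e1 : (a'.restrictScalars ℂ).toLinearMap ∘ₗ rB.toLinearMap ∘ₗ ξ =
        rC.toLinearMap ∘ₗ (a.restrictScalars ℂ).toLinearMap ∘ₗ ξ := by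
      ext x; exact ha _
    have e2 : (p'.restrictScalars ℂ).toLinearMap ∘ₗ rB.toLinearMap ∘ₗ ξ =
        rC.toLinearMap ∘ₗ (p.restrictScalars ℂ).toLinearMap ∘ₗ ξ := by
      ext x; exact hp _
    have e3 : g' = rC.comp g := AlgHom.ext hg
    rw [e1, e2, hξ.2, e3]
    simp only [adInv, LinearMap.algHom_comp_convMul_distrib, WithConv.toConv_ofConv]
    rfl

/-- The map on Kähler differentials induced by a homomorphism of `ℂ`-algebras. -/
def omegaMap {A' : Type} [CommRing A'] [Algebra ℂ A'] (r : A →ₐ[ℂ] A') :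
    Ω[A⁄ℂ] →ₛₗ[(r : A →+* A')] Ω[A'⁄ℂ] :=
  letI := r.toRingHom.toAlgebra
  haveI : IsScalarTower ℂ A A' := .of_algebraMap_eq fun c => (r.commutes c).symm
  { KaehlerDifferential.map ℂ ℂ A A' with
    map_smul' := fun c x => (KaehlerDifferential.map ℂ ℂ A A').map_smul c x }

end LieValued

/-! ## Principal bundles -/

section Bundles

/-- The elements of `H` as regular functions on `G = Spec H`. -/
def coordFn (H : Type) [CommRing H] [HopfAlgebra ℂ H] : H →ₐ[ℂ] Fn (grp H) ⊤ where
  __ := (Scheme.ΓSpecIso (.of H)).inv.hom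
  commutes' c :=
    congrArg (fun k => k.hom c)
      (Scheme.ΓSpecIso_inv_naturality (CommRingCat.ofHom (algebraMap ℂ H)))

/-- Pullback of regular functions on `G = Spec H` along a morphism `g : Y ⟶ G`, restricted to an
open `U ⊆ Y`. -/
def pointFn {Y : CSch} {H : Type} [CommRing H] [HopfAlgebra ℂ H] (g : Y ⟶ grp H)
    (U : Y.left.Opens) : H →ₐ[ℂ] Fn Y U :=
  (pullFn g ⊤ U (by exact le_top)).comp (coordFn H)

lemma pullFn_pointFn {Y Z : CSch} {H : Type} [CommRing H] [HopfAlgebra ℂ H] (f : Y ⟶ Z)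
    (g : Z ⟶ grp H) (V : Z.left.Opens) (U : Y.left.Opens) (h : U ≤ f.left ⁻¹ᵁ V) (x : H) :
    pullFn f V U h (pointFn g V x) = pointFn (f ≫ g) U x :=
  pullFn_pullFn f g ⊤ V U _ h _ (coordFn H x)

/-- A principal `G`-bundle over `X`, for `G = Spec H`: a complex scheme `total` over `X` with a
right action of `G`, such that `total ⟶ X` is flat, surjective and locally of finite presentation
(so that the bundle is locally trivial in the flat, equivalently étale, topology), and such that
`(u, g) ↦ (u, u g)` is an isomorphism from `total × G` to `total ×_X total`. -/
structure PrincipalBundle (X : CSch) (H : Type) [CommRing H] [HopfAlgebra ℂ H] where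
  /-- the total space -/
  total : CSch
  /-- the bundle projection -/
  proj : total ⟶ X
  /-- the right action of `G` -/
  act : total ⊗ grp H ⟶ total
  act_one : (ρ_ total).inv ≫ total ◁ η[grp H] ≫ act = 𝟙 total
  act_mul : act ▷ grp H ≫ act = (α_ total (grp H) (grp H)).hom ≫ total ◁ μ[grp H] ≫ act
  isPullback : IsPullback (fst total (grp H)) act proj proj
  flat : Flat proj.left
  surjective : Surjective proj.left
  locallyOfFinitePresentation : LocallyOfFinitePresentation proj.left

namespace PrincipalBundle

variable {X : CSch} {H : Type} [CommRing H] [HopfAlgebra ℂ H] (E : PrincipalBundle X H)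

/-- The bundle is trivial: it is isomorphic over `X`, `G`-equivariantly, to `X × G` with `G` acting
by right multiplication. -/
def IsTrivial : Prop :=
  ∃ e : E.total ≅ X ⊗ grp H, e.hom ≫ fst X (grp H) = E.proj ∧
    E.act ≫ e.hom = e.hom ▷ grp H ≫ (α_ X (grp H) (grp H)).hom ≫ X ◁ μ[grp H]

/-- The functions on the part of the total space that lies over `U`. -/
def fn (U : X.left.Opens) : Type := Fn E.total (E.proj.left ⁻¹ᵁ U)

/-- The functions on the part of `total × G` that lies over `U`. -/
def fnProd (U : X.left.Opens) : Type :=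
  Fn (E.total ⊗ grp H) ((fst E.total (grp H) ≫ E.proj).left ⁻¹ᵁ U)

instance (U : X.left.Opens) : CommRing (E.fn U) := inferInstanceAs (CommRing (Fn _ _))
instance (U : X.left.Opens) : CommRing (E.fnProd U) := inferInstanceAs (CommRing (Fn _ _))
instance (U : X.left.Opens) : Algebra ℂ (E.fn U) := inferInstanceAs (Algebra ℂ (Fn _ _))
instance (U : X.left.Opens) : Algebra ℂ (E.fnProd U) := inferInstanceAs (Algebra ℂ (Fn _ _))

instance (U : X.left.Opens) : Algebra (Fn X U) (E.fn U) :=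
  (pullFn E.proj U _ le_rfl).toRingHom.toAlgebra
instance (U : X.left.Opens) : Algebra (Fn X U) (E.fnProd U) :=
  (pullFn (fst E.total (grp H) ≫ E.proj) U _ le_rfl).toRingHom.toAlgebra

instance (U : X.left.Opens) : IsScalarTower ℂ (Fn X U) (E.fn U) :=
  .of_algebraMap_eq fun c => ((pullFn E.proj U _ le_rfl).commutes c).symm
instance (U : X.left.Opens) : IsScalarTower ℂ (Fn X U) (E.fnProd U) :=
  .of_algebraMap_eq fun c =>
    ((pullFn (fst E.total (grp H) ≫ E.proj) U _ le_rfl).commutes c).symm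

/-- Pullback of functions along the projection `total × G ⟶ total`. -/
def fstFn (U : X.left.Opens) : E.fn U →ₐ[Fn X U] E.fnProd U :=
  { pullFn (fst E.total (grp H)) (E.proj.left ⁻¹ᵁ U)
      ((fst E.total (grp H) ≫ E.proj).left ⁻¹ᵁ U) le_rfl with
    commutes' := fun _ => pullFn_pullFn .. }

/-- Pullback of functions along the action `total × G ⟶ total`. -/
def actFn (U : X.left.Opens) : E.fn U →ₐ[Fn X U] E.fnProd U :=
  { pullFn E.act (E.proj.left ⁻¹ᵁ U) ((fst E.total (grp H) ≫ E.proj).left ⁻¹ᵁ U)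
      (by rw [E.isPullback.w]; exact le_rfl) with
    commutes' := fun c =>
      (pullFn_pullFn E.act E.proj U _ _ le_rfl _ (by rw [E.isPullback.w]) c).trans
        (pullFn_congr E.isPullback.w.symm _ _ _ _ c) }

/-- Pullback of functions along the projection `total × G ⟶ G`. -/
def grpFn (U : X.left.Opens) : H →ₐ[ℂ] E.fnProd U :=
  pointFn (snd E.total (grp H)) _

/-- The sections over an open `U ⊆ X` of the adjoint bundle
`Ad(E) = E ×_G 𝔤`: the `𝔤`-valued functions `ξ` on the part of the total space over `U` with
`ξ(u g) = Ad(g⁻¹) ξ(u)`, corresponding to the section whose value below `u` is `[u, ξ(u)]`. -/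
abbrev Ad (U : X.left.Opens) : Submodule (Fn X U) (H →ₗ[ℂ] E.fn U) :=
  equivariant (E.fstFn U) (E.actFn U) (E.grpFn U)

/-- The restriction of functions on `X` from `U` to `V ⊆ U`. -/
abbrev resBase {U V : X.left.Opens} (h : V ≤ U) : Fn X U →ₐ[ℂ] Fn X V :=
  pullFn (𝟙 X) U V h

/-- The restriction of functions on the total space from the part over `U` to the part over
`V ⊆ U`. -/
def resFn {U V : X.left.Opens} (h : V ≤ U) : E.fn U →ₐ[ℂ] E.fn V :=
  pullFn (𝟙 E.total) (E.proj.left ⁻¹ᵁ U) (E.proj.left ⁻¹ᵁ V) fun _ hx => h hx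

/-- The restriction of functions on `total × G` from the part over `U` to the part over `V ⊆ U`. -/
def resFnProd {U V : X.left.Opens} (h : V ≤ U) : E.fnProd U →ₐ[ℂ] E.fnProd V :=
  pullFn (𝟙 (E.total ⊗ grp H)) ((fst E.total (grp H) ≫ E.proj).left ⁻¹ᵁ U)
    ((fst E.total (grp H) ≫ E.proj).left ⁻¹ᵁ V) fun _ hx => h hx

lemma resFn_algebraMap {U V : X.left.Opens} (h : V ≤ U) (c : Fn X U) :
    E.resFn h (algebraMap (Fn X U) (E.fn U) c) =
      algebraMap (Fn X V) (E.fn V) (resBase h c) := by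
  have h' : E.proj.left ⁻¹ᵁ V ≤ E.proj.left ⁻¹ᵁ U := fun _ hx => h hx
  exact (pullFn_pullFn (𝟙 E.total) E.proj U _ _ le_rfl h' (by simpa using h') c).trans
    ((pullFn_congr (by simp) _ _ _ (by simpa using h') c).trans
      (pullFn_pullFn E.proj (𝟙 X) U V _ h le_rfl (by simpa using h') c).symm)

lemma resFn_mem {U V : X.left.Opens} (h : V ≤ U) {ξ : H →ₗ[ℂ] E.fn U} (hξ : ξ ∈ E.Ad U) :
    (E.resFn h).toLinearMap ∘ₗ ξ ∈ E.Ad V := by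
  have h' : (fst E.total (grp H) ≫ E.proj).left ⁻¹ᵁ V ≤
    (fst E.total (grp H) ≫ E.proj).left ⁻¹ᵁ U := fun _ hx => h hx
  have h'' : (fst E.total (grp H) ≫ E.proj).left ⁻¹ᵁ V ≤
    E.act.left ⁻¹ᵁ E.proj.left ⁻¹ᵁ U := by
    refine h'.trans ?_
    rw [E.isPullback.w]; exact le_rfl
  have h0 : E.proj.left ⁻¹ᵁ V ≤ E.proj.left ⁻¹ᵁ U := fun _ hx => h hx
  refine equivariant_comp (E.resFn h) (E.resFnProd h) (fun b => ?_) (fun b => ?_) (fun x => ?_) hξ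
  · exact (pullFn_pullFn (fst E.total (grp H)) (𝟙 E.total) _ _ _ h0 le_rfl
        (by simpa using h') b).trans
      ((pullFn_congr (by simp) _ _ _ (by simpa using h') b).trans
        (pullFn_pullFn (𝟙 (E.total ⊗ grp H)) (fst E.total (grp H)) _ _ _ le_rfl h'
          (by simpa using h') b).symm)
  · exact (pullFn_pullFn E.act (𝟙 E.total) _ _ _ h0 (by rw [E.isPullback.w]; exact le_rfl)
        (by simpa using h'') b).trans
      ((pullFn_congr (by simp) _ _ _ (by simpa using h'') b).trans
        (pullFn_pullFn (𝟙 (E.total ⊗ grp H)) E.act _ _ _ (by rw [E.isPullback.w]; exact le_rfl) h'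
          (by simpa using h'') b).symm)
  · exact ((pullFn_pointFn (𝟙 (E.total ⊗ grp H)) (snd E.total (grp H)) _ _ h' x).trans
      (by rw [Category.id_comp]; rfl)).symm

/-- The restriction of sections of the adjoint bundle from `U` to `V ⊆ U`. -/
def adRes {U V : X.left.Opens} (h : V ≤ U) :
    E.Ad U →ₛₗ[(resBase h : Fn X U →+* Fn X V)] E.Ad V where
  toFun ξ := ⟨(E.resFn h).toLinearMap ∘ₗ ξ.1, E.resFn_mem h ξ.2⟩
  map_add' ξ ξ' := Subtype.ext (LinearMap.comp_add _ _ _)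
  map_smul' c ξ := Subtype.ext <| LinearMap.ext fun x => by
    change E.resFn h (c • ξ.1 x) = resBase h c • E.resFn h (ξ.1 x)
    rw [Algebra.smul_def, map_mul, E.resFn_algebraMap, Algebra.smul_def]

end PrincipalBundle

/-- A Higgs field on a principal `G`-bundle `E`: a global section `φ` of `Ad(E) ⊗ Ω¹` with
`[φ, φ] = 0` in `Ad(E) ⊗ Ω²`. A global section of a quasi-coherent sheaf is given by its
restrictions to the affine open subsets `U`, a family of sections compatible with restriction; the
sections of `Ad(E) ⊗ Ω¹` over an affine `U` are `Ad(E)(U) ⊗ Ω¹(U)`. -/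
structure HiggsField {X : CSch} {H : Type} [CommRing H] [HopfAlgebra ℂ H]
    (E : PrincipalBundle X H) where
  /-- the restriction of `φ` to an affine open set -/
  val : ∀ U : X.left.affineOpens, E.Ad U.1 ⊗[Fn X U.1] Ω[Fn X U.1⁄ℂ]
  compatible : ∀ (U V : X.left.affineOpens) (h : V.1 ≤ U.1),
    TensorProduct.map (E.adRes h) (omegaMap (PrincipalBundle.resBase h)) (val U) = val V
  integrable : ∀ U : X.left.affineOpens,
    TensorProduct.map₂ (bracket (E.fstFn U.1) (E.actFn U.1) (E.grpFn U.1)) (wedge (Fn X U.1))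
      (val U) (val U) = 0

/-- A principal Higgs `G`-bundle over `X`. -/
structure PrincipalHiggsBundle (X : CSch) (H : Type) [CommRing H] [HopfAlgebra ℂ H] where
  /-- the underlying principal bundle -/
  bundle : PrincipalBundle X H
  /-- the Higgs field -/
  higgs : HiggsField bundle

/-- A principal Higgs bundle is trivial if the principal bundle is trivial and the Higgs field is
zero. -/
def PrincipalHiggsBundle.IsTrivial {X : CSch} {H : Type} [CommRing H] [HopfAlgebra ℂ H]
    (𝔈 : PrincipalHiggsBundle X H) : Prop :=
  𝔈.bundle.IsTrivial ∧ ∀ U, 𝔈.higgs.val U = 0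

/-- A morphism from a principal `G`-bundle `E` to a principal `G'`-bundle `E'` over `X`, relative to
the group homomorphism `λ : G → G'` given on coordinate rings by `l : ℂ[G'] → ℂ[G]`: a morphism `f`
over `X` with `f(u g) = f(u) λ(g)`. -/
structure BundleHom {X : CSch} {H H' : Type} [CommRing H] [HopfAlgebra ℂ H] [CommRing H']
    [HopfAlgebra ℂ H'] (E : PrincipalBundle X H) (E' : PrincipalBundle X H')
    (l : H' →ₐc[ℂ] H) where
  /-- the morphism of total spaces -/
  hom : E.total ⟶ E'.total
  hom_proj : hom ≫ E'.proj = E.proj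
  equivariant : E.act ≫ hom = (hom ⊗ₘ grpHom l) ≫ E'.act

namespace BundleHom

variable {X : CSch} {H H' : Type} [CommRing H] [HopfAlgebra ℂ H] [CommRing H']
    [HopfAlgebra ℂ H'] {E : PrincipalBundle X H} {E' : PrincipalBundle X H'}
    {l : H' →ₐc[ℂ] H} (f : BundleHom E E' l)

/-- Pullback of functions along `f`. -/
def pullback (U : X.left.Opens) : E'.fn U →ₐ[Fn X U] E.fn U :=
  { pullFn f.hom (E'.proj.left ⁻¹ᵁ U) (E.proj.left ⁻¹ᵁ U)
      (by rw [← f.hom_proj]; exact le_rfl) with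
    commutes' := fun c =>
      (pullFn_pullFn f.hom E'.proj U _ _ le_rfl _ (by rw [f.hom_proj]) c).trans
        (pullFn_congr f.hom_proj _ _ _ _ c) }

/-- For a section of `Ad(E)`, given by the equivariant function `ξ`, the function
`λ_* ∘ ξ : E → 𝔤'`, where `λ_* : 𝔤 → 𝔤'` is the differential of `λ`. -/
def push (_ : BundleHom E E' l) (U : X.left.Opens) :
    E.Ad U →ₗ[Fn X U] (H' →ₗ[ℂ] E.fn U) where
  toFun ξ := ξ.1 ∘ₗ (l : H' →ₐ[ℂ] H).toLinearMap
  map_add' _ _ := rfl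
  map_smul' _ _ := rfl

/-- For a section of `Ad(E')`, given by the equivariant function `ξ'`, the function
`ξ' ∘ f : E → 𝔤'`. -/
def pull (U : X.left.Opens) : E'.Ad U →ₗ[Fn X U] (H' →ₗ[ℂ] E.fn U) where
  toFun ξ := ((f.pullback U).restrictScalars ℂ).toLinearMap ∘ₗ ξ.1
  map_add' _ _ := LinearMap.comp_add _ _ _
  map_smul' c ξ := by ext x; simp

/-- `f` maps the Higgs field `φ` of `E` to the Higgs field `φ'` of `E'`, i.e.
`(f_* ⊗ id)(φ) = φ'`. The map `f_* : Ad(E) → Ad(E')`, `[u, α] ↦ [f(u), λ_* α]`, sends the section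
given by `ξ` to the section given by `ξ'` precisely if `ξ' ∘ f = λ_* ∘ ξ`; the equality
`(f_* ⊗ id)(φ) = φ'` is accordingly expressed after pullback to `E`. -/
def MapsHiggs (φ : HiggsField E) (φ' : HiggsField E') : Prop :=
  ∀ U : X.left.affineOpens,
    (f.push U.1).rTensor Ω[Fn X U.1⁄ℂ] (φ.val U) = (f.pull U.1).rTensor Ω[Fn X U.1⁄ℂ] (φ'.val U)

/-- The image of `f_* : Ad(E) → Ad(E')`, over an open `U ⊆ X`. -/
def adImage (U : X.left.Opens) : Submodule (Fn X U) (E'.Ad U) :=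
  (LinearMap.range (f.push U)).comap (f.pull U)

end BundleHom

/-- `𝔈'`, together with the equivariant morphism `f : 𝔈 → 𝔈'`, is the principal Higgs bundle
`𝔈 ×_λ G'` obtained from `𝔈` by extension of the structure group along `λ : G → G'`, with the
induced Higgs field. An equivariant morphism to a principal `G'`-bundle determines that bundle
up to a unique isomorphism (the induced morphism from `E ×_λ G'` is a morphism of principal
`G'`-bundles over `X`, hence an isomorphism). -/
structure HiggsExtension {X : CSch} {H H' : Type} [CommRing H] [HopfAlgebra ℂ H] [CommRing H']
    [HopfAlgebra ℂ H'] (𝔈 : PrincipalHiggsBundle X H) (𝔈' : PrincipalHiggsBundle X H')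
    (l : H' →ₐc[ℂ] H) extends BundleHom 𝔈.bundle 𝔈'.bundle l where
  mapsHiggs : toBundleHom.MapsHiggs 𝔈.higgs 𝔈'.higgs

/-- A reduction of the structure group of `E` from `G` to a closed subgroup `K`, given on coordinate
rings by `l : ℂ[G] → ℂ[K]`: a principal `K`-bundle `F` with an injective `K`-equivariant morphism
`F → E`. -/
structure Reduction {X : CSch} {H K : Type} [CommRing H] [HopfAlgebra ℂ H] [CommRing K]
    [HopfAlgebra ℂ K] (E : PrincipalBundle X H) (l : H →ₐc[ℂ] K) where
  /-- the reduced bundle -/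
  bundle : PrincipalBundle X K
  /-- its inclusion into `E` -/
  incl : BundleHom bundle E l
  mono : Mono incl.hom

/-- A reduction `F` of the structure group of `E` is a Higgs reduction of `(E, φ)` if `φ` lies in
the kernel of the projection `Ad(E) ⊗ Ω¹ → (Ad(E) / Ad(F)) ⊗ Ω¹`. -/
def Reduction.IsHiggsReduction {X : CSch} {H K : Type} [CommRing H] [HopfAlgebra ℂ H] [CommRing K]
    [HopfAlgebra ℂ K] {E : PrincipalBundle X H} {l : H →ₐc[ℂ] K} (F : Reduction E l)
    (φ : HiggsField E) : Prop :=
  ∀ U : X.left.affineOpens,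
    LinearMap.rTensor Ω[Fn X U.1⁄ℂ]
      (Submodule.mkQ (R := Fn X U.1) (M := E.Ad U.1) (F.incl.adImage U.1)) (φ.val U) = 0

end Bundles

end PrincipalHiggs
end

open PrincipalHiggs

namespace PrincipalHiggs

/-! ### The quotient homomorphism and its kernel -/

section GroupHom

variable {H H' : Type} [CommRing H] [HopfAlgebra ℂ H] [CommRing H'] [HopfAlgebra ℂ H']

/-! Write `K` for the subgroup `D(G)` and `λ : G → R` for the quotient. What drives the proof is the
exact sequence `1 → K → G → R → 1`: `λ` is faithfully flat and `K` is its scheme-theoretic kernel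
(`isPullback_kernel`). Bundles and Higgs fields are treated separately.

Bundles. A trivialisation of `E ×_G R` yields a map `h : E → R` with `h(ug) = h(u) λ(g)`, and the
fibre `F = h⁻¹(1)` is a `K`-reduction of `E` (`kernelReduction`): two points of `F` over the same
point of `X` differ by some `g` with `λ(g) = 1`. The delicate point is that `F → X` is flat and
surjective. The translation map `F × G → E` is a base change of `λ`
(`isPullback_unitFibre_translate`), so `F × G → E → X` is flat and surjective, and flatness descends
along `F × G → F`. Conversely, for a `K`-reduction `F` the composite `F → E → E ×_G R` is
`K`-invariant, hence descends along `F → X` to a section, and a torsor with a section is trivial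
(`isTrivial_of_reduction`).

Higgs fields. For every `K`-reduction `F`, the subsheaf `Ad(F)` of `Ad(E)` is exactly the kernel of
`λ_*` (`adImage_le_ker_push`, `ker_push_le_adImage`). Since `X` is smooth, `Ω¹` is flat over affine
opens, so `φ` dies in `(Ad(E)/Ad(F)) ⊗ Ω¹` if and only if `λ_* φ = 0` (`rTensor_eq_zero_of_ker_le`).
Now `λ_* φ` is the pullback to `E` of the induced field on `E ×_G R`, and this pullback is injective
(`pull_injective`), also after tensoring with `Ω¹`. Hence the induced field vanishes if and only if
a given reduction is a Higgs reduction, and the reduction found for the bundle needs no adjustment.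
-/

instance isMonHom_grpHom (l : H' →ₐc[ℂ] H) : IsMonHom (grpHom l) :=
  inferInstanceAs (IsMonHom ((bialgSpec (.of ℂ)).map (.op (CommBialgCat.ofHom l))).hom)

lemma mk_eq_algebraMap_counit {R : Type} [CommRing R] [HopfAlgebra ℂ R] {l : R →ₐc[ℂ] H}
    {I : Ideal H} (hl : IsQuotientHom l I) (r : R) :
    Ideal.Quotient.mk I (l r) = algebraMap ℂ (H ⧸ I) (Coalgebra.counit r) := by
  have h : l (r - algebraMap ℂ R (Coalgebra.counit r)) ∈ I := by
    rw [← hl.kernel]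
    exact Ideal.mem_map_of_mem (l : R →ₐ[ℂ] H) (by simp [RingHom.mem_ker])
  rw [map_sub, ← Ideal.Quotient.eq_zero_iff_mem, map_sub, sub_eq_zero] at h
  rw [h]
  exact congrArg (Ideal.Quotient.mk I) ((l : R →ₐ[ℂ] H).commutes _)

/-- Since `I` is generated by the image of the augmentation ideal of `R`, the quotient `H ⧸ I` is `H
⊗_R ℂ`. Applying `Spec` turns this into the kernel square of `λ`. -/
lemma isPushout_counit {R : Type} [CommRing R] [HopfAlgebra ℂ R] {l : R →ₐc[ℂ] H}
    {I : Ideal H} (hl : IsQuotientHom l I) :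
    IsPushout (CommRingCat.ofHom (l : R →ₐ[ℂ] H).toRingHom)
      (CommRingCat.ofHom (Bialgebra.counitAlgHom ℂ R).toRingHom)
      (CommRingCat.ofHom (Ideal.Quotient.mk I))
      (CommRingCat.ofHom (algebraMap ℂ (H ⧸ I))) := by
  have w : CommRingCat.ofHom (l : R →ₐ[ℂ] H).toRingHom ≫ CommRingCat.ofHom (Ideal.Quotient.mk I) =
      CommRingCat.ofHom (Bialgebra.counitAlgHom ℂ R).toRingHom ≫
        CommRingCat.ofHom (algebraMap ℂ (H ⧸ I)) := by
    ext r; exact mk_eq_algebraMap_counit hl r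
  have hs (s : Limits.PushoutCocone (CommRingCat.ofHom (l : R →ₐ[ℂ] H).toRingHom)
      (CommRingCat.ofHom (Bialgebra.counitAlgHom ℂ R).toRingHom)) :
      I ≤ RingHom.ker s.inl.hom := by
    rw [← hl.kernel, Ideal.map_le_iff_le_comap]
    intro r hr
    have h1 := congrArg (fun k => k.hom r) s.condition
    change s.inl.hom (l r) = s.inr.hom (Coalgebra.counit r) at h1
    change s.inl.hom (l r) = 0
    rw [h1, show (Coalgebra.counit r : ℂ) = 0 from hr, map_zero]
  refine ⟨⟨w⟩, ⟨Limits.PushoutCocone.IsColimit.mk w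
    (fun s => CommRingCat.ofHom (Ideal.Quotient.lift I s.inl.hom fun x hx => hs s hx))
    (fun s => ?_) (fun s => ?_) (fun s m h _ => ?_)⟩⟩
  · ext x; rfl
  · ext c
    -- The counit is surjective, so agreement on `ℂ` may be tested on elements of `R`, where it is
    -- the cocone condition.
    obtain ⟨r, rfl⟩ : ∃ r : R, Coalgebra.counit r = c := ⟨algebraMap ℂ R c, by simp⟩
    have h1 := congrArg (fun k => k.hom r) s.condition
    change s.inl.hom (l r) = s.inr.hom (Coalgebra.counit r) at h1
    change Ideal.Quotient.lift I s.inl.hom (fun x hx => hs s hx) (algebraMap ℂ (H ⧸ I) (Coalgebra.counit r)) =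
      s.inr.hom (Coalgebra.counit r)
    rw [← mk_eq_algebraMap_counit hl]
    exact h1
  · ext x
    exact congrArg (fun k => k.hom x) h

/-- The closed subgroup with ideal `I` is the kernel of the quotient homomorphism. -/
lemma isPullback_kernel {R : Type} [CommRing R] [HopfAlgebra ℂ R] {l : R →ₐc[ℂ] H}
    {I : Ideal H} [I.IsHopfIdeal ℂ] (hl : IsQuotientHom l I) :
    IsPullback (grpHom (Bialgebra.Quotient.mkBialgHom I)) (toUnit _) (grpHom l) η[grp R] :=
  .of_map (Over.forget _) (by ext : 1; exact
      (isPullback_SpecMap_of_isPushout _ _ _ _ (isPushout_counit hl)).w)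
    (isPullback_SpecMap_of_isPushout _ _ _ _ (isPushout_counit hl))

lemma flat_grpHom {R : Type} [CommRing R] [HopfAlgebra ℂ R] {l : R →ₐc[ℂ] H}
    {I : Ideal H} (hl : IsQuotientHom l I) : Flat (grpHom l).left :=
  ((flat_and_surjective_SpecMap_iff _).2 hl.faithfullyFlat).1

lemma surjective_grpHom {R : Type} [CommRing R] [HopfAlgebra ℂ R] {l : R →ₐc[ℂ] H}
    {I : Ideal H} (hl : IsQuotientHom l I) : Surjective (grpHom l).left :=
  ((flat_and_surjective_SpecMap_iff _).2 hl.faithfullyFlat).2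

variable (H)

lemma flat_grp : Flat (grp H).hom := by
  change Flat (Spec.map (CommRingCat.ofHom (algebraMap ℂ H)))
  rw [Flat.SpecMap_iff, CommRingCat.hom_ofHom, RingHom.flat_algebraMap_iff]
  infer_instance

lemma mono_one_grp : Mono η[grp H] :=
  ⟨fun _ _ _ => toUnit_unique (C := CSch) _ _⟩

/-- The augmentation ideal is finitely generated because `H` is noetherian. By base change this
makes the inclusion of a unit fibre locally of finite presentation. -/
lemma locallyOfFinitePresentation_one_grp [Algebra.FiniteType ℂ H] :
    LocallyOfFinitePresentation η[grp H].left := by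
  change LocallyOfFinitePresentation
    (Spec.map (CommRingCat.ofHom (Bialgebra.counitAlgHom ℂ H).toRingHom))
  rw [HasRingHomProperty.Spec_iff (P := @LocallyOfFinitePresentation)]
  have : IsNoetherianRing H := Algebra.FiniteType.isNoetherianRing ℂ H
  exact RingHom.FinitePresentation.of_surjective _ (fun c => ⟨algebraMap ℂ H c, by simp⟩)
    (IsNoetherian.noetherian _)

end GroupHom

/-! ### Faithfully flat descent -/

section Schemes

/-- Injectivity of `B ⊗_A f` may be tested after applying `C ⊗_B -`, and there it becomes
injectivity of `C ⊗_A f`. -/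
lemma _root_.Module.Flat.of_flat_of_faithfullyFlat (A B C : Type*) [CommRing A] [CommRing B]
    [CommRing C] [Algebra A B] [Algebra B C] [Algebra A C] [IsScalarTower A B C]
    [Module.FaithfullyFlat B C] [Module.Flat A C] : Module.Flat A B := by
  rw [Module.Flat.iff_lTensor_preserves_injective_linearMap]
  intro N P _ _ _ _ f hf
  have h : Function.Injective (LinearMap.lTensor C (f.baseChange B)) := by
    have e : ((TensorProduct.AlgebraTensorModule.cancelBaseChange A B B C P).toLinearMap :
        _ →ₗ[B] _) ∘ₗ LinearMap.lTensor C (f.baseChange B) =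
        (f.baseChange C).restrictScalars B ∘ₗ
        (TensorProduct.AlgebraTensorModule.cancelBaseChange A B B C N).toLinearMap := by
      ext; simp
    refine Function.Injective.of_comp
      (f := (TensorProduct.AlgebraTensorModule.cancelBaseChange A B B C P)) ?_
    have e' := congrArg (fun k : _ →ₗ[B] _ => ⇑k) e
    simp only [LinearMap.coe_comp] at e'
    refine e' ▸ Function.Injective.comp ?_ (LinearEquiv.injective _)
    exact Module.Flat.lTensor_preserves_injective_linearMap f hf
  exact (Module.FaithfullyFlat.lTensor_injective_iff_injective B C (f.baseChange B)).1 h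

/-- A flat local homomorphism of local rings is faithfully flat, so descent can be carried out on
stalks. -/
lemma faithfullyFlat_stalkMap {X Y : Scheme} (f : X ⟶ Y) [Flat f] (x : X) :
    (f.stalkMap x).hom.FaithfullyFlat := by
  have h := Flat.stalkMap f x
  set φ := (f.stalkMap x).hom
  algebraize [φ]
  have : IsLocalHom (algebraMap (Y.presheaf.stalk (f x)) (X.presheaf.stalk x)) :=
    inferInstanceAs (IsLocalHom φ)
  exact Module.FaithfullyFlat.of_flat_of_isLocalHom

/-- Flatness of `g` can be checked after precomposition with a flat surjective morphism. -/
lemma flat_of_flat_comp {X Y Z : Scheme} (f : X ⟶ Y) (g : Y ⟶ Z) [Flat f] [Surjective f]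
    [Flat (f ≫ g)] : Flat g := by
  refine Flat.of_stalkMap _ fun y => ?_
  obtain ⟨x, rfl⟩ := f.surjective y
  have hf := faithfullyFlat_stalkMap f x
  have hfg : ((f.stalkMap x).hom.comp (g.stalkMap (f x)).hom).Flat :=
    (congrArg (fun k => RingHom.Flat (CommRingCat.Hom.hom k))
      (Scheme.Hom.stalkMap_comp f g x)).mp (Flat.stalkMap (f ≫ g) x)
  algebraize [(f.stalkMap x).hom, (g.stalkMap (f x)).hom,
    (f.stalkMap x).hom.comp (g.stalkMap (f x)).hom]
  exact Module.Flat.of_flat_of_faithfullyFlat _ _ (X.presheaf.stalk x)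

/-- A flat surjective morphism is injective on functions. -/
lemma app_injective_of_flat_of_surjective {X Y : Scheme} (f : X ⟶ Y) [Flat f] [Surjective f]
    (U : Y.Opens) : Function.Injective (f.app U) := by
  intro s t h
  -- Sections are determined by their germs, and each stalk of `Y` injects into the stalk at a point
  -- of `X` above.
  refine Y.IsSheaf.section_ext fun y hy => ?_
  obtain ⟨x, rfl⟩ := f.surjective y
  have e : Y.presheaf.germ U (f x) hy s = Y.presheaf.germ U (f x) hy t := by
    refine (faithfullyFlat_stalkMap f x).injective ?_
    rw [← ConcreteCategory.comp_apply]
    have := congrArg (X.presheaf.germ (f ⁻¹ᵁ U) x hy) h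
    simpa using this
  obtain ⟨V, hV, i, j, hij⟩ := TopCat.Presheaf.germ_eq _ _ _ _ _ _ e
  exact ⟨V, leOfHom i, hV, hij⟩

lemma pullFn_injective {Y Z : CSch} (f : Y ⟶ Z) [Flat f.left] [Surjective f.left]
    (V : Z.left.Opens) (U : Y.left.Opens) (h : U = f.left ⁻¹ᵁ V) :
    Function.Injective (pullFn f V U h.le) := by
  subst h
  change Function.Injective (f.left.appLE V _ _)
  rw [Scheme.Hom.appLE_eq_app]
  exact app_injective_of_flat_of_surjective f.left V

/-- Kähler differentials of a smooth scheme are flat over affine opens. -/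
lemma flat_kaehler {X : CSch} (hX : Smooth X.hom) (U : X.left.affineOpens) :
    Module.Flat (Fn X U.1) Ω[Fn X U.1⁄ℂ] := by
  have h : (algebraMap ℂ (Fn X U.1)).Smooth := by
    refine RingHom.Smooth.comp (f := (Scheme.ΓSpecIso (.of ℂ)).inv.hom) ?_
      (X.hom.smooth_appLE (isAffineOpen_top _) U.2 le_top)
    exact .of_bijective (ConcreteCategory.bijective_of_isIso (Scheme.ΓSpecIso (.of ℂ)).inv)
  have : Algebra.Smooth ℂ (Fn X U.1) := by
    exact RingHom.smooth_algebraMap.1 h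
  infer_instance

/-- A flat surjective morphism, locally of finite presentation, is the quotient by its kernel pair
in the category of complex schemes. -/
lemma exists_desc {Y X Z : CSch} (f : Y ⟶ X) [Flat f.left] [Surjective f.left]
    [LocallyOfFinitePresentation f.left] {P : CSch} {p q : P ⟶ Y} (hpq : IsPullback p q f f)
    (k : Y ⟶ Z) (hk : p ≫ k = q ≫ k) : ∃ s : X ⟶ Z, f ≫ s = k := by
  -- The effective epimorphism property concerns all pairs of scheme morphisms coequalised by `f`.
  -- Such a pair factors through the kernel pair, which remains a pullback after forgetting the base
  -- `Spec ℂ`.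
  have h : ∀ {T : Scheme} (g₁ g₂ : T ⟶ Y.left), g₁ ≫ f.left = g₂ ≫ f.left →
      g₁ ≫ k.left = g₂ ≫ k.left := by
    intro T g₁ g₂ hg
    have hP : IsPullback p.left q.left f.left f.left := hpq.map (Over.forget _)
    rw [← hP.lift_fst g₁ g₂ hg, Category.assoc, ← Over.comp_left, hk, Over.comp_left,
      hP.lift_snd_assoc]
  have := Flat.epi_of_flat_of_surjective f.left
  refine ⟨Over.homMk (EffectiveEpi.desc f.left k.left h) ?_, ?_⟩
  · rw [← cancel_epi f.left, EffectiveEpi.fac_assoc]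
    simp
  · ext : 1
    exact EffectiveEpi.fac f.left k.left h

end Schemes

/-- This permits pullback squares of torsors to be verified on `T`-valued points, as if they were
sets. -/
lemma isPullback_of_exists {C : Type*} [Category C] {P A B Z : C} {p : P ⟶ A} {q : P ⟶ B}
    {f : A ⟶ Z} {g : B ⟶ Z} (w : p ≫ f = q ≫ g)
    (ex : ∀ (T : C) (a : T ⟶ A) (b : T ⟶ B), a ≫ f = b ≫ g → ∃ k : T ⟶ P, k ≫ p = a ∧ k ≫ q = b)
    (uniq : ∀ (T : C) (k k' : T ⟶ P), k ≫ p = k' ≫ p → k ≫ q = k' ≫ q → k = k') :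
    IsPullback p q f g := by
  choose k h1 h2 using ex
  exact ⟨⟨w⟩, ⟨Limits.PullbackCone.IsLimit.mk w (fun s => k _ s.fst s.snd s.condition)
    (fun s => h1 _ _ _ _) (fun s => h2 _ _ _ _)
    fun s m e1 e2 => uniq _ _ _ (e1.trans (h1 _ _ _ _).symm) (e2.trans (h2 _ _ _ _).symm)⟩⟩

/-! ### Torsor calculus on `T`-valued points -/

namespace PrincipalBundle

variable {X : CSch} {H : Type} [CommRing H] [HopfAlgebra ℂ H] (E : PrincipalBundle X H)

/-- The translate `u g` of a `T`-valued point `u` of the total space by a `T`-valued point `g` of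
the group. -/
noncomputable abbrev translate {T : CSch} (u : T ⟶ E.total) (g : T ⟶ grp H) : T ⟶ E.total := lift u g ≫ E.act

lemma comp_translate {S T : CSch} (k : S ⟶ T) (u : T ⟶ E.total) (g : T ⟶ grp H) :
    k ≫ E.translate u g = E.translate (k ≫ u) (k ≫ g) := by
  rw [translate, ← Category.assoc, comp_lift]

lemma translate_proj {T : CSch} (u : T ⟶ E.total) (g : T ⟶ grp H) :
    E.translate u g ≫ E.proj = u ≫ E.proj := by
  rw [translate, Category.assoc, ← E.isPullback.w, lift_fst_assoc]

lemma translate_one {T : CSch} (u : T ⟶ E.total) : E.translate u (1 : T ⟶ grp H) = u := by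
  have h : lift u (1 : T ⟶ grp H) = u ≫ (ρ_ E.total).inv ≫ E.total ◁ η[grp H] := by
    ext1
    · simp only [lift_fst, Category.assoc, whiskerLeft_fst, rightUnitor_inv_fst, Category.comp_id]
    · simp only [lift_snd, Category.assoc, whiskerLeft_snd, Hom.one_def]
      rw [← Category.assoc, ← Category.assoc]
      congr 1
      exact toUnit_unique _ _
  rw [translate, h, Category.assoc, Category.assoc, E.act_one, Category.comp_id]

lemma translate_mul {T : CSch} (u : T ⟶ E.total) (g g' : T ⟶ grp H) :
    E.translate (E.translate u g) g' = E.translate u (g * g') := by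
  have h := congrArg (fun k => lift (lift u g) g' ≫ k) E.act_mul
  simp only [lift_whiskerRight_assoc, lift_lift_associator_hom_assoc, lift_whiskerLeft_assoc] at h
  exact h

/-- The isomorphism `E × G ≅ E ×_X E` splits into transitivity on fibres, given here, and freeness,
given by `translate_injective`. -/
lemma exists_translate {T : CSch} (u v : T ⟶ E.total) (h : u ≫ E.proj = v ≫ E.proj) :
    ∃ g : T ⟶ grp H, E.translate u g = v := by
  refine ⟨E.isPullback.lift u v h ≫ snd _ _, ?_⟩
  have : lift u (E.isPullback.lift u v h ≫ snd _ _) = E.isPullback.lift u v h := by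
    ext1
    · rw [lift_fst, E.isPullback.lift_fst]
    · rw [lift_snd]
  rw [translate, this, E.isPullback.lift_snd]

lemma translate_injective {T : CSch} (u : T ⟶ E.total) {g g' : T ⟶ grp H}
    (h : E.translate u g = E.translate u g') : g = g' := by
  have : lift u g = lift u g' := E.isPullback.hom_ext (by simp) h
  simpa using congrArg (fun k => k ≫ snd _ _) this

/-- For `j : Y ⟶ E` the morphism `Y × G ⟶ E`, `(y, g) ↦ j(y) g`, is the base change of
`Y ⟶ X`. -/
lemma isPullback_translate {Y : CSch} (j : Y ⟶ E.total) :
    IsPullback (fst Y (grp H)) (j ▷ grp H ≫ E.act) (j ≫ E.proj) E.proj := by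
  have e {T : CSch} (k : T ⟶ Y ⊗ grp H) : k ≫ j ▷ grp H ≫ E.act =
      E.translate (k ≫ fst _ _ ≫ j) (k ≫ snd _ _) := by
    rw [translate, ← Category.assoc]
    congr 1
    ext1 <;> simp
  refine isPullback_of_exists ?_ (fun T y u h => ?_) (fun T k k' h1 h2 => ?_)
  · rw [Category.assoc, ← E.isPullback.w, whiskerRight_fst_assoc]
  · obtain ⟨g, hg⟩ := E.exists_translate (y ≫ j) u (by rw [Category.assoc, h])
    exact ⟨lift y g, lift_fst _ _, by rw [e, lift_fst_assoc, lift_snd, hg]⟩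
  · rw [e, e, reassoc_of% h1] at h2
    exact CartesianMonoidalCategory.hom_ext _ _ h1 (E.translate_injective _ h2)

/-- A principal bundle with a section is trivial. -/
lemma isTrivial_of_section (s : X ⟶ E.total) (hs : s ≫ E.proj = 𝟙 X) : E.IsTrivial := by
  have h := E.isPullback_translate s
  -- With `s` a section, `(x, g) ↦ s(x) g` is a base change of `𝟙 X`, hence an isomorphism; its
  -- inverse is the trivialisation.
  rw [hs] at h
  have : IsIso (s ▷ grp H ≫ E.act) := h.isIso_snd_of_isIso
  refine ⟨(asIso (s ▷ grp H ≫ E.act)).symm, ?_, ?_⟩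
  · rw [Iso.symm_hom, asIso_inv, IsIso.inv_comp_eq, ← h.w, Category.comp_id]
  -- Equivariance of the inverse is equivalent to that of `(x, g) ↦ s(x) g`, which is associativity
  -- of the action.
  · rw [Iso.symm_hom, asIso_inv, ← cancel_mono (s ▷ grp H ≫ E.act), Category.assoc,
      IsIso.inv_hom_id, Category.comp_id, ← cancel_epi ((s ▷ grp H ≫ E.act) ▷ grp H)]
    simp only [Category.assoc]
    rw [← comp_whiskerRight_assoc, IsIso.hom_inv_id, id_whiskerRight, Category.id_comp,
      comp_whiskerRight_assoc, E.act_mul]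
    rw [associator_naturality_left_assoc, whisker_exchange_assoc]

end PrincipalBundle

namespace BundleHom

variable {X : CSch} {H H' : Type} [CommRing H] [HopfAlgebra ℂ H] [CommRing H']
  [HopfAlgebra ℂ H'] {E : PrincipalBundle X H} {E' : PrincipalBundle X H'}
  {l : H' →ₐc[ℂ] H}

lemma translate_hom (f : BundleHom E E' l) {T : CSch} (u : T ⟶ E.total) (g : T ⟶ grp H) :
    E.translate u g ≫ f.hom = E'.translate (u ≫ f.hom) (g ≫ grpHom l) := by
  rw [PrincipalBundle.translate, Category.assoc, f.equivariant, lift_map_assoc]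

end BundleHom

/-! ### Points of the kernel -/

section Kernel

variable {H R : Type} [CommRing H] [HopfAlgebra ℂ H] [CommRing R] [HopfAlgebra ℂ R]
  {l : R →ₐc[ℂ] H} {I : Ideal H} [I.IsHopfIdeal ℂ] 
lemma comp_incl_grpHom (hl : IsQuotientHom l I) {T : CSch} (d : T ⟶ grp (H ⧸ I)) :
    d ≫ grpHom (Bialgebra.Quotient.mkBialgHom I) ≫ grpHom l = 1 := by
  rw [(isPullback_kernel hl).w, ← Category.assoc, toUnit_unique (d ≫ toUnit _) (toUnit _)]
  rfl

lemma exists_factor_of_comp_eq_one (hl : IsQuotientHom l I) {T : CSch} (g : T ⟶ grp H) (hg : g ≫ grpHom l = 1) :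
    ∃ d : T ⟶ grp (H ⧸ I), d ≫ grpHom (Bialgebra.Quotient.mkBialgHom I) = g :=
  ⟨(isPullback_kernel hl).lift g (toUnit _) hg, (isPullback_kernel hl).lift_fst ..⟩

lemma mono_incl (hl : IsQuotientHom l I) : Mono (grpHom (Bialgebra.Quotient.mkBialgHom I)) :=
  have := mono_one_grp R
  ⟨fun _ _ h => (isPullback_kernel hl).hom_ext h (toUnit_unique _ _)⟩

end Kernel

/-! ### From a reduction to a trivialisation -/

section Section

variable {X : CSch} {H R : Type} [CommRing H] [HopfAlgebra ℂ H] [CommRing R] [HopfAlgebra ℂ R]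
  {l : R →ₐc[ℂ] H} {I : Ideal H} [I.IsHopfIdeal ℂ] 
  {E : PrincipalBundle X H} {E' : PrincipalBundle X R} (f : BundleHom E E' l)
/-- If `E` admits a reduction to the kernel of `G → G'`, then `E ×_G G'` is trivial. -/
lemma isTrivial_of_reduction (hl : IsQuotientHom l I) (f : BundleHom E E' l)
    (F : Reduction E (Bialgebra.Quotient.mkBialgHom I)) :
    E'.IsTrivial := by
  have := F.bundle.flat
  have := F.bundle.surjective
  have := F.bundle.locallyOfFinitePresentation
  -- The kernel acts trivially after passing to `E'`, because `f(wd) = f(w) λ(d) = f(w)`. So `F →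
  -- E'` equalises the kernel pair of `F → X`.
  have h : fst F.bundle.total _ ≫ F.incl.hom ≫ f.hom =
      F.bundle.act ≫ F.incl.hom ≫ f.hom := by
    have e : F.bundle.act = F.bundle.translate (fst _ _) (snd _ _) := by
      rw [PrincipalBundle.translate, lift_fst_snd, Category.id_comp]
    rw [e, ← Category.assoc (F.bundle.translate _ _), F.incl.translate_hom, f.translate_hom,
      Category.assoc (snd _ _), comp_incl_grpHom hl, E'.translate_one, Category.assoc]
  obtain ⟨s, hs⟩ := exists_desc F.bundle.proj F.bundle.isPullback _ h
  refine E'.isTrivial_of_section s ?_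
  have : Epi F.bundle.proj.left := Flat.epi_of_flat_of_surjective _
  have : Epi F.bundle.proj := (Over.forget _).epi_of_epi_map this
  rw [← cancel_epi F.bundle.proj, reassoc_of% hs, f.hom_proj, F.incl.hom_proj, Category.comp_id]

end Section

/-- A morphism `h` from the total space of `E` to the group `R` is equivariant along the
homomorphism `λ : G → R` if `h(u g) = h(u) λ(g)`. -/
def PrincipalBundle.IsEquivariantMap {X : CSch} {H R : Type} [CommRing H] [HopfAlgebra ℂ H]
    [CommRing R] [HopfAlgebra ℂ R] (E : PrincipalBundle X H) (l : R →ₐc[ℂ] H)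
    (h : E.total ⟶ grp R) : Prop :=
  ∀ ⦃T : CSch⦄ (u : T ⟶ E.total) (g : T ⟶ grp H),
    E.translate u g ≫ h = (u ≫ h) * (g ≫ grpHom l)

lemma BundleHom.exists_isEquivariantMap {X : CSch} {H R : Type} [CommRing H] [HopfAlgebra ℂ H]
    [CommRing R] [HopfAlgebra ℂ R] {E : PrincipalBundle X H} {E' : PrincipalBundle X R}
    {l : R →ₐc[ℂ] H} (f : BundleHom E E' l) (hE' : E'.IsTrivial) :
    ∃ h : E.total ⟶ grp R, E.IsEquivariantMap l h := by
  obtain ⟨e, -, he⟩ := hE'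
  -- The group component of the trivialisation `E' ≅ X × R`, composed with `f`.
  refine ⟨f.hom ≫ e.hom ≫ snd _ _, fun T u g => ?_⟩
  rw [← Category.assoc, f.translate_hom, PrincipalBundle.translate, Category.assoc,
    reassoc_of% he, whiskerLeft_snd, lift_whiskerRight_assoc]
  have e1 : lift ((u ≫ f.hom) ≫ e.hom) (g ≫ grpHom l) =
      lift (lift (u ≫ f.hom ≫ e.hom ≫ fst _ _) (u ≫ f.hom ≫ e.hom ≫ snd _ _))
        (g ≫ grpHom l) := by
    congr 1
    ext1 <;> simp
  rw [e1, lift_lift_associator_hom_assoc, lift_snd_assoc, Hom.mul_def]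

/-! ### From an equivariant map to a reduction: the unit fibre -/

section KernelBundle

variable {X : CSch} {H R : Type} [CommRing H] [HopfAlgebra ℂ H] [CommRing R] [HopfAlgebra ℂ R]
  {l : R →ₐc[ℂ] H} {I : Ideal H} 
  {E : PrincipalBundle X H} {h : E.total ⟶ grp R}

/-- The fibre over the unit element of a morphism from the total space to a group. -/
noncomputable abbrev unitFibre (h : E.total ⟶ grp R) : CSch := Limits.pullback h η[grp R]

/-- The inclusion of the fibre over the unit element. -/
noncomputable abbrev unitFibreIncl (h : E.total ⟶ grp R) : unitFibre h ⟶ E.total :=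
  Limits.pullback.fst h η[grp R]

instance mono_unitFibreIncl : Mono (unitFibreIncl h) :=
  have := mono_one_grp R
  inferInstanceAs (Mono (Limits.pullback.fst h η[grp R]))

lemma unitFibreIncl_comp : unitFibreIncl h ≫ h = 1 := by
  rw [Limits.pullback.condition, toUnit_unique (Limits.pullback.snd h η[grp R]) (toUnit _)]
  rfl

lemma exists_unitFibre_lift {T : CSch} (u : T ⟶ E.total) (hu : u ≫ h = 1) :
    ∃ w : T ⟶ unitFibre h, w ≫ unitFibreIncl h = u :=
  ⟨Limits.pullback.lift u (toUnit _) hu, Limits.pullback.lift_fst ..⟩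

lemma comp_unitFibreIncl {T : CSch} (w : T ⟶ unitFibre h) : w ≫ unitFibreIncl h ≫ h = 1 := by
  rw [unitFibreIncl_comp, MonObj.comp_one]

lemma translate_unitFibreIncl [I.IsHopfIdeal ℂ] (hl : IsQuotientHom l I) (hh : E.IsEquivariantMap l h) {T : CSch}
    (w : T ⟶ unitFibre h) (d : T ⟶ grp (H ⧸ I)) :
    E.translate (w ≫ unitFibreIncl h) (d ≫ grpHom (Bialgebra.Quotient.mkBialgHom I)) ≫ h = 1 := by
  rw [hh, Category.assoc, Category.assoc, comp_unitFibreIncl, comp_incl_grpHom hl, one_mul]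

/-- The translation morphism `F × G ⟶ E` from the unit fibre `F` is a base change of `G ⟶ R`. -/
lemma isPullback_unitFibre_translate (hh : E.IsEquivariantMap l h) :
    IsPullback (E.translate (fst (unitFibre h) (grp H) ≫ unitFibreIncl h) (snd _ _))
      (snd (unitFibre h) (grp H)) h (grpHom l) := by
  refine isPullback_of_exists ?_ (fun T u g hg => ?_) (fun T k k' h1 h2 => ?_)
  · rw [hh, Category.assoc, comp_unitFibreIncl, one_mul]
  -- If `h(u) = λ(g)`, then `u g⁻¹` lies in the unit fibre, and `u = (u g⁻¹) g`.
  · obtain ⟨w, hw⟩ := exists_unitFibre_lift (h := h) (E.translate u g⁻¹) (by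
      rw [hh, hg, GrpObj.inv_comp, mul_inv_cancel])
    refine ⟨lift w g, ?_, lift_snd _ _⟩
    rw [E.comp_translate, lift_fst_assoc, lift_snd, hw, E.translate_mul, inv_mul_cancel,
      E.translate_one]
  · refine CartesianMonoidalCategory.hom_ext _ _ ?_ h2
    rw [E.comp_translate, E.comp_translate, h2] at h1
    have := congrArg (fun u => E.translate u (k' ≫ snd _ _)⁻¹) h1
    simp only [E.translate_mul, mul_inv_cancel, E.translate_one] at this
    rwa [← cancel_mono (unitFibreIncl h), Category.assoc, Category.assoc]

lemma isPullback_fst_grp (Y : CSch) (H : Type) [CommRing H] [HopfAlgebra ℂ H] :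
    IsPullback (fst Y (grp H)).left (snd Y (grp H)).left Y.hom (grp H).hom :=
  .of_hasPullback Y.hom (grp H).hom

lemma flat_fst (Y : CSch) (H : Type) [CommRing H] [HopfAlgebra ℂ H] :
    Flat (fst Y (grp H)).left :=
  MorphismProperty.of_isPullback (P := @Flat) (isPullback_fst_grp Y H).flip (flat_grp H)

/-- The unit section splits the projection. -/
lemma surjective_fst (Y : CSch) (H : Type) [CommRing H] [HopfAlgebra ℂ H] :
    Surjective (fst Y (grp H)).left := by
  have e : (lift (𝟙 Y) (1 : Y ⟶ grp H)).left ≫ (fst Y (grp H)).left = 𝟙 _ := by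
    rw [← Over.comp_left, lift_fst, Over.id_left]
  have : Surjective ((lift (𝟙 Y) (1 : Y ⟶ grp H)).left ≫ (fst Y (grp H)).left) := by
    rw [e]; infer_instance
  exact .of_comp (lift (𝟙 Y) (1 : Y ⟶ grp H)).left _

lemma unitFibre_translate_proj :
    (E.translate (fst (unitFibre h) (grp H) ≫ unitFibreIncl h) (snd _ _)).left ≫ E.proj.left =
      (fst (unitFibre h) (grp H)).left ≫ (unitFibreIncl h ≫ E.proj).left := by
  rw [← Over.comp_left, ← Over.comp_left, E.translate_proj, Category.assoc]

/-- `F × G → E` is a base change of `λ`, so its composite with `E → X` is flat. This composite is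
also `F × G → F → X`, whose first map is flat and surjective, so flatness descends to `F → X`. -/
lemma flat_unitFibre (hl : IsQuotientHom l I) (hh : E.IsEquivariantMap l h) :
    Flat (unitFibreIncl h ≫ E.proj).left := by
  have := flat_fst (unitFibre h) H
  have := surjective_fst (unitFibre h) H
  have := E.flat
  have : Flat (E.translate (fst (unitFibre h) (grp H) ≫ unitFibreIncl h) (snd _ _)).left :=
    MorphismProperty.of_isPullback (P := @Flat)
      ((isPullback_unitFibre_translate hh).map (Over.forget _)).flip (flat_grpHom hl)
  have : Flat ((fst (unitFibre h) (grp H)).left ≫ (unitFibreIncl h ≫ E.proj).left) := by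
    rw [← unitFibre_translate_proj]; infer_instance
  exact flat_of_flat_comp (fst (unitFibre h) (grp H)).left _

lemma surjective_unitFibre (hl : IsQuotientHom l I) (hh : E.IsEquivariantMap l h) :
    Surjective (unitFibreIncl h ≫ E.proj).left := by
  have := E.surjective
  have : Surjective (E.translate (fst (unitFibre h) (grp H) ≫ unitFibreIncl h) (snd _ _)).left :=
    MorphismProperty.of_isPullback (P := @Surjective)
      ((isPullback_unitFibre_translate hh).map (Over.forget _)).flip (surjective_grpHom hl)
  have : Surjective ((fst (unitFibre h) (grp H)).left ≫ (unitFibreIncl h ≫ E.proj).left) := by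
    rw [← unitFibre_translate_proj]; infer_instance
  exact .of_comp (fst (unitFibre h) (grp H)).left _

/-- No descent is needed here: `F → E` is a base change of the unit of `R`. -/
lemma locallyOfFinitePresentation_unitFibre [Algebra.FiniteType ℂ R] :
    LocallyOfFinitePresentation (unitFibreIncl h ≫ E.proj).left := by
  have := E.locallyOfFinitePresentation
  have : LocallyOfFinitePresentation (unitFibreIncl h).left :=
    MorphismProperty.of_isPullback (P := @LocallyOfFinitePresentation)
      ((IsPullback.of_hasPullback h η[grp R]).map (Over.forget _)).flip
      (locallyOfFinitePresentation_one_grp R)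
  rw [Over.comp_left]
  infer_instance

/-- The action of the kernel of `G → R` on the unit fibre of an equivariant morphism to `R`. -/
noncomputable def unitFibreAct [I.IsHopfIdeal ℂ] (hl : IsQuotientHom l I) (hh : E.IsEquivariantMap l h) :
    unitFibre h ⊗ grp (H ⧸ I) ⟶ unitFibre h :=
  (exists_unitFibre_lift _ (translate_unitFibreIncl hl hh (fst _ _) (snd _ _))).choose

/-- The action is a chosen lift through a monomorphism, so this formula determines it. The torsor
axioms for `F` are verified through it, inside `E`. -/
lemma comp_unitFibreAct_incl [I.IsHopfIdeal ℂ] (hl : IsQuotientHom l I) (hh : E.IsEquivariantMap l h) {T : CSch}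
    (k : T ⟶ unitFibre h ⊗ grp (H ⧸ I)) :
    k ≫ unitFibreAct hl hh ≫ unitFibreIncl h =
      E.translate (k ≫ fst _ _ ≫ unitFibreIncl h)
        (k ≫ snd _ _ ≫ grpHom (Bialgebra.Quotient.mkBialgHom I)) := by
  rw [unitFibreAct, (exists_unitFibre_lift _
    (translate_unitFibreIncl hl hh (fst _ _) (snd _ _))).choose_spec, E.comp_translate]

/-- The unit fibre of an equivariant morphism to `R` is a principal bundle for the kernel of
`G → R`. -/
noncomputable def kernelBundle [I.IsHopfIdeal ℂ] [Algebra.FiniteType ℂ R] (hl : IsQuotientHom l I)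
    (hh : E.IsEquivariantMap l h) : PrincipalBundle X (H ⧸ I) where
  total := unitFibre h
  proj := unitFibreIncl h ≫ E.proj
  act := unitFibreAct hl hh
  act_one := by
    have e : (ρ_ (unitFibre h)).inv ≫ unitFibre h ◁ η[grp (H ⧸ I)] = lift (𝟙 _) 1 := by
      ext1
      · rw [Category.assoc, whiskerLeft_fst, rightUnitor_inv_fst, lift_fst]
      · rw [Category.assoc, whiskerLeft_snd, lift_snd, Hom.one_def, ← Category.assoc]
        congr 1
        exact toUnit_unique _ _
    rw [← Category.assoc, e, ← cancel_mono (unitFibreIncl h), Category.assoc,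
      comp_unitFibreAct_incl, lift_fst_assoc, lift_snd_assoc, MonObj.one_comp, E.translate_one]
  act_mul := by
    rw [← cancel_mono (unitFibreIncl h)]
    simp only [Category.assoc]
    rw [comp_unitFibreAct_incl, whiskerRight_fst_assoc, whiskerRight_snd_assoc,
      comp_unitFibreAct_incl, E.translate_mul]
    have e := comp_unitFibreAct_incl hl hh ((α_ (unitFibre h) (grp (H ⧸ I)) (grp (H ⧸ I))).hom ≫
      unitFibre h ◁ μ[grp (H ⧸ I)])
    simp only [Category.assoc, whiskerLeft_fst_assoc, whiskerLeft_snd_assoc,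
      associator_hom_fst_assoc] at e
    rw [e]
    congr 1
    rw [← Category.assoc (fst _ _) (snd _ _), ← MonObj.mul_comp, ← Category.assoc _ μ,
      ← Category.assoc, ← Category.assoc, Hom.mul_def]
    congr 2
    ext1 <;> simp
  isPullback := by
    have := mono_incl hl
    refine isPullback_of_exists ?_ (fun T u v huv => ?_) (fun T k k' h1 h2 => ?_)
    · have e := comp_unitFibreAct_incl hl hh (𝟙 _)
      simp only [Category.id_comp] at e
      rw [reassoc_of% e]
      exact ((E.translate_proj _ _).trans (Category.assoc _ _ _)).symm
    · obtain ⟨g, hg⟩ := E.exists_translate (u ≫ unitFibreIncl h) (v ≫ unitFibreIncl h) (by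
        simpa only [Category.assoc] using huv)
      -- Applying `h` to `u g = v`, with `h = 1` on both points, gives `λ(g) = 1`, so `g` comes from
      -- the kernel.
      obtain ⟨d, rfl⟩ := exists_factor_of_comp_eq_one hl g (by
        have := congrArg (fun k => k ≫ h) hg
        simpa only [hh _ _, Category.assoc, comp_unitFibreIncl, one_mul] using this)
      refine ⟨lift u d, lift_fst _ _, ?_⟩
      rw [← cancel_mono (unitFibreIncl h), Category.assoc, comp_unitFibreAct_incl,
        lift_fst_assoc, lift_snd_assoc, hg]
    · refine CartesianMonoidalCategory.hom_ext _ _ h1 ?_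
      have h3 := congrArg (fun k => k ≫ unitFibreIncl h) h2
      simp only [Category.assoc] at h3
      rw [comp_unitFibreAct_incl, comp_unitFibreAct_incl, reassoc_of% h1] at h3
      rw [← cancel_mono (grpHom (Bialgebra.Quotient.mkBialgHom I)), Category.assoc, Category.assoc]
      exact E.translate_injective _ h3
  flat := flat_unitFibre hl hh
  surjective := surjective_unitFibre hl hh
  locallyOfFinitePresentation := locallyOfFinitePresentation_unitFibre

/-- The reduction of the structure group to the kernel of `G → R` given by an equivariant
morphism to `R`. -/
noncomputable def kernelReduction [I.IsHopfIdeal ℂ] [Algebra.FiniteType ℂ R] (hl : IsQuotientHom l I)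
    (hh : E.IsEquivariantMap l h) : Reduction E (Bialgebra.Quotient.mkBialgHom I) where
  bundle := kernelBundle hl hh
  incl :=
    { hom := unitFibreIncl h
      hom_proj := rfl
      equivariant := by
        have e := comp_unitFibreAct_incl hl hh (𝟙 _)
        simp only [Category.id_comp] at e
        refine e.trans ?_
        rw [PrincipalBundle.translate]
        congr 1 }
  mono := mono_unitFibreIncl

end KernelBundle

/-! ### Convolution and the adjoint action -/

section Algebra

variable {H H' C C' : Type} [CommRing H] [HopfAlgebra ℂ H] [CommRing H'] [HopfAlgebra ℂ H']
  [CommRing C] [Algebra ℂ C] [CommRing C'] [Algebra ℂ C']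

/-- The two sides are a left and a right convolution inverse of `l`, hence equal. -/
lemma antipode_comp_bialgHom (l : H' →ₐc[ℂ] H) :
    HopfAlgebra.antipode ℂ ∘ₗ (l : H' →ₗ[ℂ] H) =
      (l : H' →ₗ[ℂ] H) ∘ₗ HopfAlgebra.antipode ℂ := by
  have h1 : WithConv.toConv (HopfAlgebra.antipode ℂ ∘ₗ (l : H' →ₗ[ℂ] H)) *
      WithConv.toConv (l : H' →ₗ[ℂ] H) = 1 := by
    have := LinearMap.convMul_comp_coalgHom_distrib (WithConv.toConv (HopfAlgebra.antipode ℂ))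
      (WithConv.toConv (LinearMap.id (M := H) (R := ℂ))) (l : H' →ₗc[ℂ] H)
    rw [LinearMap.antipode_mul_id] at this
    refine Eq.trans (congrArg WithConv.toConv this).symm ?_
    ext x
    simp
  have h2 : WithConv.toConv (l : H' →ₗ[ℂ] H) *
      WithConv.toConv ((l : H' →ₗ[ℂ] H) ∘ₗ HopfAlgebra.antipode ℂ) = 1 := by
    have := LinearMap.algHom_comp_convMul_distrib (l : H' →ₐ[ℂ] H)
      (WithConv.toConv (LinearMap.id (M := H') (R := ℂ)))
      (WithConv.toConv (HopfAlgebra.antipode ℂ))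
    rw [LinearMap.id_mul_antipode] at this
    refine Eq.trans (congrArg WithConv.toConv this).symm ?_
    ext x
    simp only [LinearMap.convOne_apply]
    exact (l : H' →ₐ[ℂ] H).commutes _
  exact WithConv.toConv_injective (left_inv_eq_right_inv h1 h2)

/-- This is `λ_* ∘ Ad(g⁻¹) = Ad(λ(g)⁻¹) ∘ λ_*`: a bialgebra homomorphism respects convolution and
the antipode. -/
lemma adInv_comp_bialgHom (l : H' →ₐc[ℂ] H) (g : H →ₐ[ℂ] C) (ξ : H →ₗ[ℂ] C) :
    adInv g ξ ∘ₗ (l : H' →ₐ[ℂ] H).toLinearMap =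
      adInv (g.comp (l : H' →ₐ[ℂ] H)) (ξ ∘ₗ (l : H' →ₐ[ℂ] H).toLinearMap) := by
  have h1 := LinearMap.convMul_comp_coalgHom_distrib
    (WithConv.toConv (g.toLinearMap ∘ₗ HopfAlgebra.antipode ℂ) * WithConv.toConv ξ)
    (WithConv.toConv g.toLinearMap) (l : H' →ₗc[ℂ] H)
  have h2 := LinearMap.convMul_comp_coalgHom_distrib
    (WithConv.toConv (g.toLinearMap ∘ₗ HopfAlgebra.antipode ℂ)) (WithConv.toConv ξ)
    (l : H' →ₗc[ℂ] H)
  refine h1.trans ?_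
  rw [h2, WithConv.toConv_ofConv]
  exact congrArg (fun k => (WithConv.toConv (g.toLinearMap ∘ₗ k) *
    WithConv.toConv (ξ ∘ₗ (l : H' →ₗ[ℂ] H)) *
    WithConv.toConv (g.toLinearMap ∘ₗ (l : H' →ₗ[ℂ] H))).ofConv) (antipode_comp_bialgHom l)

lemma algHom_comp_adInv (r : C →ₐ[ℂ] C') (g : H →ₐ[ℂ] C) (ξ : H →ₗ[ℂ] C) :
    r.toLinearMap ∘ₗ adInv g ξ = adInv (r.comp g) (r.toLinearMap ∘ₗ ξ) := by
  simp only [adInv, LinearMap.algHom_comp_convMul_distrib, WithConv.toConv_ofConv]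
  rfl

lemma adInv_zero (g : H →ₐ[ℂ] C) : adInv g (0 : H →ₗ[ℂ] C) = 0 := by
  simp [adInv]

lemma lieValued_one {ξ : H →ₗ[ℂ] C} (hξ : ξ ∈ lieValued H C) : ξ 1 = 0 := by
  simpa using hξ 1 1

lemma lieValued_algebraMap {ξ : H →ₗ[ℂ] C} (hξ : ξ ∈ lieValued H C) (c : ℂ) :
    ξ (algebraMap ℂ H c) = 0 := by
  rw [Algebra.algebraMap_eq_smul_one, map_smul, lieValued_one hξ, smul_zero]

end Algebra

/-! ### Equivariant functions and their pullbacks -/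

namespace PrincipalBundle

variable {X : CSch} {H H' : Type} [CommRing H] [HopfAlgebra ℂ H] [CommRing H'] [HopfAlgebra ℂ H']
  (E : PrincipalBundle X H)

/-- An equivariant function on the total space of a principal bundle vanishes if its pullback to
a faithfully flat cover of the base vanishes. -/
lemma eq_zero_of_pullFn_eq_zero {U : X.left.Opens} (g : H' →ₐ[ℂ] E.fnProd U)
    {ζ : H' →ₗ[ℂ] E.fn U}
    (hζ : ((E.actFn U).restrictScalars ℂ).toLinearMap ∘ₗ ζ =
      adInv g (((E.fstFn U).restrictScalars ℂ).toLinearMap ∘ₗ ζ))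
    {Y : CSch} (j : Y ⟶ E.total) (hflat : Flat (j ≫ E.proj).left)
    (hsurj : Surjective (j ≫ E.proj).left) {V : Y.left.Opens}
    (hV : V ≤ j.left ⁻¹ᵁ E.proj.left ⁻¹ᵁ U) (hV' : j.left ⁻¹ᵁ E.proj.left ⁻¹ᵁ U ≤ V)
    (h0 : ∀ x, pullFn j (E.proj.left ⁻¹ᵁ U) V hV (ζ x) = 0) : ζ = 0 := by
  -- The map `(y, g) ↦ j(y) g` from `Y × G` to `E` is a base change of `Y → X`, so it is flat and
  -- surjective and hence injective on functions. It suffices that `ζ(j(y) g) = Ad(g⁻¹) ζ(j(y)) =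
  -- 0`, with `g` read through the given point; `hfst` supplies the vanishing of `ζ(j(y))`.
  have hm : IsPullback (fst Y (grp H)).left (j ▷ grp H ≫ E.act).left (j ≫ E.proj).left
    E.proj.left := (E.isPullback_translate j).map (Over.forget _)
  have : Flat (j ▷ grp H ≫ E.act).left := MorphismProperty.of_isPullback (P := @Flat) hm hflat
  have : Surjective (j ▷ grp H ≫ E.act).left :=
    MorphismProperty.of_isPullback (P := @Surjective) hm hsurj
  have e1 : (j ▷ grp H ≫ E.act) ≫ E.proj = (j ▷ grp H) ≫ fst E.total (grp H) ≫ E.proj := by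
    rw [Category.assoc, ← E.isPullback.w]
  have e2 : (j ▷ grp H) ≫ fst E.total (grp H) = fst _ _ ≫ j := whiskerRight_fst _ _
  let W := (j ▷ grp H ≫ E.act).left ⁻¹ᵁ E.proj.left ⁻¹ᵁ U
  have hW : W ≤ (j ▷ grp H).left ⁻¹ᵁ (fst E.total (grp H) ≫ E.proj).left ⁻¹ᵁ U :=
    (congrArg (fun k : Y ⊗ grp H ⟶ X => k.left ⁻¹ᵁ U) e1).le
  have hW' : W ≤ (fst Y (grp H)).left ⁻¹ᵁ V :=
    (hW.trans (congrArg (fun k : Y ⊗ grp H ⟶ E.total =>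
      k.left ⁻¹ᵁ E.proj.left ⁻¹ᵁ U) e2).le).trans fun _ hx => hV' hx
  let r : E.fnProd U →ₐ[ℂ] Fn (Y ⊗ grp H) W :=
    pullFn (j ▷ grp H) ((fst E.total (grp H) ≫ E.proj).left ⁻¹ᵁ U) W hW
  have hfst : r.toLinearMap ∘ₗ ((E.fstFn U).restrictScalars ℂ).toLinearMap ∘ₗ ζ = 0 := by
    ext x
    refine (pullFn_pullFn (j ▷ grp H) (fst E.total (grp H)) (E.proj.left ⁻¹ᵁ U)
      ((fst E.total (grp H) ≫ E.proj).left ⁻¹ᵁ U) W le_rfl hW (by exact hW) (ζ x)).trans ?_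
    refine (pullFn_congr e2 _ _ _ (fun _ hx => hV (hW' hx)) (ζ x)).trans ?_
    refine (pullFn_pullFn (fst Y (grp H)) j _ V W hV hW' _ (ζ x)).symm.trans ?_
    rw [h0, map_zero, LinearMap.zero_apply]
  have hact : r.toLinearMap ∘ₗ ((E.actFn U).restrictScalars ℂ).toLinearMap ∘ₗ ζ = 0 := by
    rw [hζ, algHom_comp_adInv, hfst, adInv_zero]
  ext x
  refine pullFn_injective (j ▷ grp H ≫ E.act) (E.proj.left ⁻¹ᵁ U) W rfl ?_
  refine Eq.trans ?_ (map_zero _).symm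
  refine (pullFn_pullFn (j ▷ grp H) E.act (E.proj.left ⁻¹ᵁ U)
    ((fst E.total (grp H) ≫ E.proj).left ⁻¹ᵁ U) W (by rw [E.isPullback.w]; exact le_rfl) hW
    le_rfl (ζ x)).symm.trans ?_
  exact LinearMap.congr_fun hact x

end PrincipalBundle

namespace BundleHom

variable {X : CSch} {H H' : Type} [CommRing H] [HopfAlgebra ℂ H] [CommRing H'] [HopfAlgebra ℂ H']
  {E : PrincipalBundle X H} {E' : PrincipalBundle X H'} {l : H' →ₐc[ℂ] H}

lemma preimage_proj (f : BundleHom E E' l) (U : X.left.Opens) :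
    f.hom.left ⁻¹ᵁ E'.proj.left ⁻¹ᵁ U = E.proj.left ⁻¹ᵁ U :=
  congrArg (fun k : E.total ⟶ X => k.left ⁻¹ᵁ U) f.hom_proj

/-- The pullback of sections of `Ad(E')` to equivariant functions on `E` is injective. -/
lemma pull_injective (f : BundleHom E E' l) (U : X.left.Opens) :
    Function.Injective (f.pull U) := by
  rw [injective_iff_map_eq_zero]
  intro ξ hξ
  refine Subtype.ext (E'.eq_zero_of_pullFn_eq_zero (E'.grpFn U) ξ.2.2 f.hom ?_ ?_
    (f.preimage_proj U).ge (f.preimage_proj U).le fun x => LinearMap.congr_fun hξ x)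
  · rw [f.hom_proj]; exact E.flat
  · rw [f.hom_proj]; exact E.surjective

/-- Pullback of functions along `f × λ : E × G ⟶ E' × G'`. -/
noncomputable def pullbackProd (f : BundleHom E E' l) (U : X.left.Opens) :
    E'.fnProd U →ₐ[ℂ] E.fnProd U :=
  pullFn (f.hom ⊗ₘ grpHom l) ((fst E'.total (grp H') ≫ E'.proj).left ⁻¹ᵁ U)
    ((fst E.total (grp H) ≫ E.proj).left ⁻¹ᵁ U)
    (congrArg (fun k : E.total ⊗ grp H ⟶ X => k.left ⁻¹ᵁ U)
      (by rw [tensorHom_fst_assoc, f.hom_proj] :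
        fst E.total (grp H) ≫ E.proj = (f.hom ⊗ₘ grpHom l) ≫ fst _ _ ≫ E'.proj)).le

lemma pullbackProd_fstFn (f : BundleHom E E' l) (U : X.left.Opens) (x : E'.fn U) :
    f.pullbackProd U (E'.fstFn U x) = E.fstFn U (f.pullback U x) := by
  have e : (f.hom ⊗ₘ grpHom l) ≫ fst E'.total (grp H') = fst E.total (grp H) ≫ f.hom :=
    tensorHom_fst _ _
  have h : (fst E.total (grp H) ≫ E.proj).left ⁻¹ᵁ U ≤
      (fst E.total (grp H) ≫ f.hom).left ⁻¹ᵁ E'.proj.left ⁻¹ᵁ U :=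
    (congrArg (fun V => (fst E.total (grp H)).left ⁻¹ᵁ V) (f.preimage_proj U)).ge
  refine (pullFn_pullFn (f.hom ⊗ₘ grpHom l) (fst E'.total (grp H')) (E'.proj.left ⁻¹ᵁ U) _ _ _ _
    (e ▸ h) x).trans ((pullFn_congr e _ _ _ h x).trans
    (pullFn_pullFn (fst E.total (grp H)) f.hom (E'.proj.left ⁻¹ᵁ U) (E.proj.left ⁻¹ᵁ U) _
      (f.preimage_proj U).ge _ h x).symm)

lemma pullbackProd_actFn (f : BundleHom E E' l) (U : X.left.Opens) (x : E'.fn U) :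
    f.pullbackProd U (E'.actFn U x) = E.actFn U (f.pullback U x) := by
  have e : (f.hom ⊗ₘ grpHom l) ≫ E'.act = E.act ≫ f.hom := f.equivariant.symm
  have h : (fst E.total (grp H) ≫ E.proj).left ⁻¹ᵁ U ≤
      (E.act ≫ f.hom).left ⁻¹ᵁ E'.proj.left ⁻¹ᵁ U :=
    (congrArg (fun k : E.total ⊗ grp H ⟶ X => k.left ⁻¹ᵁ U)
      (by rw [E.isPullback.w, Category.assoc, f.hom_proj] :
        fst E.total (grp H) ≫ E.proj = (E.act ≫ f.hom) ≫ E'.proj)).le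
  refine (pullFn_pullFn (f.hom ⊗ₘ grpHom l) E'.act (E'.proj.left ⁻¹ᵁ U) _ _ _ _
    (e ▸ h) x).trans ((pullFn_congr e _ _ _ h x).trans
    (pullFn_pullFn E.act f.hom (E'.proj.left ⁻¹ᵁ U) (E.proj.left ⁻¹ᵁ U) _
      (f.preimage_proj U).ge _ h x).symm)

lemma pointFn_comp_grpHom {Y : CSch} (g : Y ⟶ grp H) (l : H' →ₐc[ℂ] H) (U : Y.left.Opens)
    (x : H') : pointFn (g ≫ grpHom l) U x = pointFn g U (l x) := by
  have h : pullFn (grpHom l) ⊤ ⊤ le_top (coordFn H' x) = coordFn H (l x) := by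
    change ((Scheme.ΓSpecIso (.of H')).inv ≫ (grpHom l).left.appLE ⊤ ⊤ le_top).hom x = _
    rw [show (grpHom l).left.appLE ⊤ ⊤ le_top = (grpHom l).left.appTop from
      Scheme.Hom.appLE_eq_app _]
    exact (congrArg (fun k => k.hom x)
      (Scheme.ΓSpecIso_inv_naturality (CommRingCat.ofHom (l : H' →ₐ[ℂ] H).toRingHom))).symm
  refine (pullFn_pullFn g (grpHom l) ⊤ ⊤ U le_top le_top le_top (coordFn H' x)).symm.trans ?_
  rw [h]
  rfl

lemma pullbackProd_grpFn (f : BundleHom E E' l) (U : X.left.Opens) (x : H') :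
    f.pullbackProd U (E'.grpFn U x) = E.grpFn U (l x) := by
  refine (pullFn_pointFn (f.hom ⊗ₘ grpHom l) (snd E'.total (grp H')) _ _ _ x).trans ?_
  rw [tensorHom_snd]
  exact pointFn_comp_grpHom _ l _ x

end BundleHom

/-! ### `Ad(F)` as the kernel of `λ_*` -/

section Reduction

variable {X : CSch} {H R : Type} [CommRing H] [HopfAlgebra ℂ H] [CommRing R] [HopfAlgebra ℂ R]
  {l : R →ₐc[ℂ] H} {I : Ideal H} {E : PrincipalBundle X H} {E' : PrincipalBundle X R}

/-- Sections of `Ad(F)`, for a reduction `F` of `E` to the kernel of `G → R`, map to zero in the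
Lie algebra of `R`. -/
lemma adImage_le_ker_push [I.IsHopfIdeal ℂ] (hl : IsQuotientHom l I) (f : BundleHom E E' l)
    (F : Reduction E (Bialgebra.Quotient.mkBialgHom I)) (U : X.left.Opens) :
    F.incl.adImage U ≤ LinearMap.ker (f.push U) := by
  rintro ξ ⟨ω, hω⟩
  rw [LinearMap.mem_ker]
  -- The function `λ_* ξ` lives on `E` but takes values in the Lie algebra of `R`; it transforms
  -- under `Ad(λ(g)⁻¹)`. It therefore suffices to show that it vanishes on `F`.
  refine E.eq_zero_of_pullFn_eq_zero ((E.grpFn U).comp (l : R →ₐ[ℂ] H)) ?_ F.incl.hom ?_ ?_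
    (F.incl.preimage_proj U).ge (F.incl.preimage_proj U).le fun r => ?_
  · exact (congrArg (fun k : H →ₗ[ℂ] E.fnProd U => k ∘ₗ (l : R →ₐ[ℂ] H).toLinearMap) ξ.2.2).trans
      (adInv_comp_bialgHom l _ _)
  · rw [F.incl.hom_proj]; exact F.bundle.flat
  · rw [F.incl.hom_proj]; exact F.bundle.surjective
  · refine (LinearMap.congr_fun hω (l r)).symm.trans ?_
    -- Functions pulled back from `R` are constant on the kernel, and derivations kill constants.
    change ω.1 (Ideal.Quotient.mk I (l r)) = 0
    rw [mk_eq_algebraMap_counit hl]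
    exact lieValued_algebraMap ω.2.1 _

/-- Sections of `Ad(E)` that map to zero in the Lie algebra of `R` come from sections of `Ad(F)`,
for every reduction `F` of `E` to the kernel of `G → R`. -/
lemma ker_push_le_adImage [I.IsHopfIdeal ℂ] (hl : IsQuotientHom l I) (f : BundleHom E E' l)
    (F : Reduction E (Bialgebra.Quotient.mkBialgHom I)) (U : X.left.Opens) :
    LinearMap.ker (f.push U) ≤ F.incl.adImage U := by
  intro ξ hξ
  have hξ0 (r : R) : ξ.1 (l r) = 0 := LinearMap.congr_fun (LinearMap.mem_ker.1 hξ) r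
  -- The ideal `I` is generated by `l(r)` with `ε(r) = 0`. The vanishing of the counit is carried
  -- along because `ξ(ax) = ε(a) ξ(x) + ε(x) ξ(a)` needs both.
  have hI (x : H) (hx : x ∈ I) : Coalgebra.counit (R := ℂ) x = 0 ∧ ξ.1 x = 0 := by
    rw [← hl.kernel] at hx
    induction hx using Submodule.span_induction with
    | mem x hx =>
      obtain ⟨r, hr, rfl⟩ := hx
      exact ⟨(CoalgHomClass.counit_comp_apply l r).trans hr, hξ0 r⟩
    | zero => simp
    | add x y _ _ hx hy => simp [hx, hy]
    | smul a x _ hx =>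
      rw [smul_eq_mul]
      exact ⟨by simp [hx], by rw [ξ.2.1 a x, hx.1, hx.2, smul_zero, zero_smul, add_zero]⟩
  let q : H →ₐ[ℂ] H ⧸ I := Ideal.Quotient.mkₐ ℂ I
  have hq : Function.Surjective q := Ideal.Quotient.mkₐ_surjective ℂ I
  let ζ : H →ₗ[ℂ] F.bundle.fn U := F.incl.pull U ξ
  have hζ (x : H) : ζ x = F.incl.pullback U (ξ.1 x) := rfl
  obtain ⟨ω, hω⟩ : ∃ ω : H ⧸ I →ₗ[ℂ] F.bundle.fn U, ω ∘ₗ q.toLinearMap = ζ := by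
    refine ⟨(Submodule.liftQ (I.restrictScalars ℂ) ζ fun x hx => ?_) ∘ₗ
      (Submodule.Quotient.restrictScalarsEquiv ℂ I).symm.toLinearMap, rfl⟩
    rw [LinearMap.mem_ker, hζ, (hI x hx).2, map_zero]
  have hω' (x : H) : ω (q x) = F.incl.pullback U (ξ.1 x) := LinearMap.congr_fun hω x
  have hcounit (x : H) : Coalgebra.counit (R := ℂ) (q x) = Coalgebra.counit (R := ℂ) x :=
    CoalgHomClass.counit_comp_apply (Bialgebra.Quotient.mkBialgHom I) x
  refine ⟨⟨ω, fun x y => ?_, ?_⟩, hω⟩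
  · obtain ⟨x, rfl⟩ := hq x
    obtain ⟨y, rfl⟩ := hq y
    rw [← map_mul, hω', hω', hω', hcounit, hcounit, ξ.2.1, map_add]
    congr 1 <;> exact map_smul ((F.incl.pullback U).restrictScalars ℂ) _ _
  -- Equivariance of `ω` is tested on `H`, where it is the equivariance of `ξ` pulled back along `F
  -- × K → E × G`.
  · refine (LinearMap.cancel_right (g := q.toLinearMap) hq).1 ?_
    have h1 := congrArg (fun k : H →ₗ[ℂ] E.fnProd U =>
      (F.incl.pullbackProd U).toLinearMap ∘ₗ k) ξ.2.2
    have e1 : (F.incl.pullbackProd U).toLinearMap ∘ₗ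
        ((E.actFn U).restrictScalars ℂ).toLinearMap ∘ₗ ξ.1 =
        (((F.bundle.actFn U).restrictScalars ℂ).toLinearMap ∘ₗ ω) ∘ₗ q.toLinearMap := by
      ext x
      exact (F.incl.pullbackProd_actFn U _).trans (congrArg _ (hω' x).symm)
    have e2 : (F.incl.pullbackProd U).toLinearMap ∘ₗ
        ((E.fstFn U).restrictScalars ℂ).toLinearMap ∘ₗ ξ.1 =
        (((F.bundle.fstFn U).restrictScalars ℂ).toLinearMap ∘ₗ ω) ∘ₗ q.toLinearMap := by
      ext x
      exact (F.incl.pullbackProd_fstFn U _).trans (congrArg _ (hω' x).symm)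
    have e3 : (F.incl.pullbackProd U).comp (E.grpFn U) = (F.bundle.grpFn U).comp q :=
      AlgHom.ext fun x => F.incl.pullbackProd_grpFn U x
    refine e1.symm.trans (h1.trans ?_)
    rw [algHom_comp_adInv, e2, e3]
    exact (adInv_comp_bialgHom (Bialgebra.Quotient.mkBialgHom I) _ _).symm

end Reduction

/-- Both maps factor through `M ⧸ ker g`. The factor of `g` is injective and stays so after
tensoring with the flat module `P`, so `x` already vanishes in `(M ⧸ ker g) ⊗ P`. -/
lemma rTensor_eq_zero_of_ker_le {A M N Q P : Type*} [CommRing A] [AddCommMonoid M] [Module A M]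
    [AddCommMonoid N] [Module A N] [AddCommMonoid Q] [Module A Q] [AddCommGroup P] [Module A P]
    [Module.Flat A P] (g : M →ₗ[A] N) (q : M →ₗ[A] Q) (hgq : ∀ m, g m = 0 → q m = 0)
    {x : M ⊗[A] P} (hx : g.rTensor P x = 0) : q.rTensor P x = 0 := by
  -- Scalar multiplication by `-1` supplies the negation needed to form quotients.
  let := Module.addCommMonoidToAddCommGroup A (M := M)
  let := Module.addCommMonoidToAddCommGroup A (M := N)
  let := Module.addCommMonoidToAddCommGroup A (M := Q)
  have h1 : g = (LinearMap.ker g).liftQ g le_rfl ∘ₗ (LinearMap.ker g).mkQ :=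
    LinearMap.ext fun _ ↦ rfl
  have h2 : q = (LinearMap.ker g).liftQ q hgq ∘ₗ (LinearMap.ker g).mkQ :=
    LinearMap.ext fun _ ↦ rfl
  rw [h1, LinearMap.rTensor_comp_apply] at hx
  have h3 := Module.Flat.rTensor_preserves_injective_linearMap (M := P) _
    (LinearMap.ker_eq_bot.1 (Submodule.ker_liftQ_eq_bot' _ _ rfl)) (hx.trans (map_zero _).symm)
  rw [h2, LinearMap.rTensor_comp_apply, h3, map_zero]

/-! ### Higgs fields and the main equivalence -/

variable {X : CSch} {H R : Type} [CommRing H] [HopfAlgebra ℂ H] [CommRing R] [HopfAlgebra ℂ R]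
  {l : R →ₐc[ℂ] H} {I : Ideal H} {𝔈 : PrincipalHiggsBundle X H} {R𝔈 : PrincipalHiggsBundle X R}

/-- If the Higgs field induced on `E ×_G R` vanishes, every reduction of `E` to the kernel of
`G → R` is a Higgs reduction. -/
lemma isHiggsReduction_of_higgs_eq_zero [I.IsHopfIdeal ℂ] (hX : Smooth X.hom)
    (hl : IsQuotientHom l I) (f : HiggsExtension 𝔈 R𝔈 l) (h0 : ∀ U, R𝔈.higgs.val U = 0)
    (F : Reduction 𝔈.bundle (Bialgebra.Quotient.mkBialgHom I)) : F.IsHiggsReduction 𝔈.higgs := by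
  intro U
  have := flat_kaehler hX U
  have hφ : (f.toBundleHom.push U.1).rTensor Ω[Fn X U.1⁄ℂ] (𝔈.higgs.val U) = 0 := by
    rw [f.mapsHiggs U, h0 U, map_zero]
  have hker (m : 𝔈.bundle.Ad U.1) (hm : f.toBundleHom.push U.1 m = 0) :
      Submodule.mkQ (R := Fn X U.1) (M := 𝔈.bundle.Ad U.1) (F.incl.adImage U.1) m = 0 :=
    (Submodule.Quotient.mk_eq_zero _).2 (ker_push_le_adImage hl f.toBundleHom F U.1 hm)
  have key := @rTensor_eq_zero_of_ker_le (Fn X U.1) (𝔈.bundle.Ad U.1) _ _ Ω[Fn X U.1⁄ℂ]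
    _ _ _ _ _ _ _ _ _ _ (f.toBundleHom.push U.1)
    (Submodule.mkQ (R := Fn X U.1) (M := 𝔈.bundle.Ad U.1) (F.incl.adImage U.1))
  exact @key hker (𝔈.higgs.val U) hφ

/-- If `E` has a Higgs reduction to the kernel of `G → R`, the Higgs field induced on `E ×_G R`
vanishes. -/
lemma higgs_eq_zero_of_isHiggsReduction [I.IsHopfIdeal ℂ] (hX : Smooth X.hom)
    (hl : IsQuotientHom l I) (f : HiggsExtension 𝔈 R𝔈 l)
    (F : Reduction 𝔈.bundle (Bialgebra.Quotient.mkBialgHom I)) (hF : F.IsHiggsReduction 𝔈.higgs)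
    (U : X.left.affineOpens) : R𝔈.higgs.val U = 0 := by
  have := flat_kaehler hX U
  have hker (m : 𝔈.bundle.Ad U.1)
      (hm : Submodule.mkQ (R := Fn X U.1) (M := 𝔈.bundle.Ad U.1) (F.incl.adImage U.1) m = 0) :
      f.toBundleHom.push U.1 m = 0 :=
    adImage_le_ker_push hl f.toBundleHom F U.1 ((Submodule.Quotient.mk_eq_zero _).1 hm)
  have key := @rTensor_eq_zero_of_ker_le (Fn X U.1) (𝔈.bundle.Ad U.1) _ _ Ω[Fn X U.1⁄ℂ]
    _ _ _ _ _ _ _ _ _ _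
    (Submodule.mkQ (R := Fn X U.1) (M := 𝔈.bundle.Ad U.1) (F.incl.adImage U.1))
    (f.toBundleHom.push U.1)
  -- The pullback of the induced field to `E` equals `λ_* φ`, which vanishes because `λ_*` kills
  -- `Ad(F)`.
  have hφ : (f.toBundleHom.pull U.1).rTensor Ω[Fn X U.1⁄ℂ] (R𝔈.higgs.val U) = 0 :=
    (f.mapsHiggs U).symm.trans (@key hker (𝔈.higgs.val U) (hF U))
  have hinj := Module.Flat.rTensor_preserves_injective_linearMap (M := Ω[Fn X U.1⁄ℂ])
    (f.toBundleHom.pull U.1) (f.toBundleHom.pull_injective U.1)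
  exact hinj (hφ.trans (map_zero _).symm)

/-- For a quotient homomorphism `G → R` with kernel `K`, the Higgs bundle `E ×_G R` is trivial if
and only if `E` has a Higgs reduction to `K`. -/
theorem isTrivial_iff_exists_isHiggsReduction [I.IsHopfIdeal ℂ] [Algebra.FiniteType ℂ R]
    (hX : Smooth X.hom) (hl : IsQuotientHom l I) (f : HiggsExtension 𝔈 R𝔈 l) :
    R𝔈.IsTrivial ↔ ∃ F : Reduction 𝔈.bundle (Bialgebra.Quotient.mkBialgHom I),
      F.IsHiggsReduction 𝔈.higgs := by
  constructor
  · rintro ⟨htriv, h0⟩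
    obtain ⟨h, hh⟩ := f.toBundleHom.exists_isEquivariantMap htriv
    exact ⟨kernelReduction hl hh, isHiggsReduction_of_higgs_eq_zero hX hl f h0 _⟩
  · rintro ⟨F, hF⟩
    exact ⟨isTrivial_of_reduction hl f.toBundleHom F,
      higgs_eq_zero_of_isHiggsReduction hX hl f F hF⟩

end PrincipalHiggs

theorem mainTheorem12
    (X : CSch) (hX : IsSmoothProjectiveVariety X)
    (H : Type) [CommRing H] [HopfAlgebra ℂ H] [Algebra.FiniteType ℂ H] (hG : IsReductive H)
    (R : Type) [CommRing R] [HopfAlgebra ℂ R] [Algebra.FiniteType ℂ R]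
    (rad : R →ₐc[ℂ] H) (hrad : IsQuotientHom rad (derivedIdeal H))
    (𝔈 : PrincipalHiggsBundle X H)
    (R𝔈 : PrincipalHiggsBundle X R) (f : HiggsExtension 𝔈 R𝔈 rad) :
    R𝔈.IsTrivial ↔
      ∃ F : Reduction 𝔈.bundle (derivedIncl H), F.IsHiggsReduction 𝔈.higgs :=
  isTrivial_iff_exists_isHiggsReduction hX.smooth hrad f
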